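/- \textbf{Setting.} Let $\Theta$ be a measurable parameter space with a $\sigma$-finite reference measure and let $\pi_0$ be a prior probability density on $\Theta$. Let $f(\cdot\mid\theta)$ be a Markov kernel from $\Theta$ to the database space $\mathcal X^n$ (the data model). Let $m_\epsilon(s\mid x)\ge 0$ be a mechanism density, fix an observed privatized statistic $s_{dp}$ and budgets $\epsilon_1,\epsilon_2,\dots$, and suppose that $x\mapsto m_{\epsilon_t}(s_{dp}\mid x)$ is measurable and bounded for every $t$. Let $K_t$ ($t\ge1$) be Markov kernels on $\Theta$ that have densities with respect to the reference measure. Put $r_t(x)=m_{\epsilon_t}(s_{dp}\mid x)/\sup_{x'}m_{\epsilon_t}(s_{dp}\mid x')$ and, for $t\ge 1$, $$\pi_{\epsilon_t}(d\theta,dx\mid s_{dp})=\frac{\pi_0(d\theta)f(dx\mid\theta)\,m_{\epsilon_t}(s_{dp}\mid x)}{c_{\epsilon_t}},\qquad c_{\epsilon_t}=\iint \pi_0(d\theta)f(dx\mid\theta)\,m_{\epsilon_t}(s_{dp}\mid x),\qquad \mathbb E_t[\varphi]=\mathbb E_{\pi_{\epsilon_t}}[\varphi];$$ also $\pi_{\epsilon_0}:=\pi_0$.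 For functions of $\theta$ alone, $\pi_{\epsilon_t}$ also denotes the $\theta$-marginal. Let $K_t(\tilde\theta,\cdot\mid A_t)$ be the law of $(\theta,x)$, where $\theta\sim K_t(\tilde\theta,\cdot)$, $x\sim f(\cdot\mid\theta)$ and $U\sim U(0,1)$ is independent, conditioned on the acceptance event $A_t=\{\pi_0(\theta)>0,\ r_t(x)>U\}$. Put $$h_t=\int\pi_{\epsilon_{t-1}}(d\tilde\theta)\,K_t(\tilde\theta,\cdot\mid A_t),\qquad w_t=\frac{d\pi_{\epsilon_t}}{dh_t}.$$ \textbf{Particle system.} Draw $\theta^{(1,0)},\dots,\theta^{(N,0)}$ i.i.d. from $\pi_0$. The ancestors $\tilde\theta^{(i,0)}$ of the first iteration are either (a) these draws themselves, $\tilde\theta^{(i,0)}=\theta^{(i,0)}$, or (b) $N$ independent uniform draws with replacement from them. In iteration $t\ge1$: given the ancestors $\tilde\theta^{(1,t-1)},\dots,\tilde\theta^{(N,t-1)}$, draw independently $(\theta,x)^{(i,t)}\sim K_t(\tilde\theta^{(i,t-1)},\cdot\mid A_t)$; compute the normalized weights $\mathbf w^{(i,t)}=w_t((\theta,x)^{(i,t)})/\sum_j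 w_t((\theta,x)^{(j,t)})$; then draw the next ancestors $\tilde\theta^{(i,t)}$ independently from $\sum_j\mathbf w^{(j,t)}\delta_{\theta^{(j,t)}}$. Let $\hat{\mathbb E}_t[\varphi]=\sum_{i=1}^N\mathbf w^{(i,t)}\varphi((\theta,x)^{(i,t)})$. \textbf{Recursive measurability.} For $t\ge 1$, $\mathcal F_t^p$ is the set of measurable $\varphi:\Theta\times\mathcal X^n\to\mathbb R$ with $\mathbb E_{h_t}|w_t\varphi|^p<\infty$ such that the function $\tilde\theta\mapsto\mathbb E_{K_t(\tilde\theta,\cdot\mid A_t)}[w_t\varphi]$ belongs to $\mathcal F_{t-1}^p$; $\mathcal F_0^p$ is the set of measurable $g:\Theta\to\mathbb R$ with $\mathbb E_{\pi_0}|g|^p<\infty$. (A function of $\theta$ is regarded as a function of $(\theta,x)$.) \textbf{Asymptotic variances.} Put $\widetilde V_0(g)=\mathrm{Var}_{\pi_0}(g)$ in case (a) and $\widetilde V_0(g)=2\,\mathrm{Var}_{\pi_0}(g)$ in case (b), and for $t\ge1$ $$\begin{aligned}\check V_t(\psi)&=\widetilde V_{t-1}\big[\mathbb E_{K_t(\cdot,\cdot\mid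 A_t)}(\psi)\big]+\mathbb E_{\pi_{\epsilon_{t-1}}}\big[\mathrm{Var}_{K_t(\cdot,\cdot\mid A_t)}(\psi)\big]&&\text{(propagation)},\\ V_t(\varphi)&=\check V_t\big[w_t\cdot(\varphi-\mathbb E_t[\varphi])\big]&&\text{(reweighting)},\\ \widetilde V_t(\varphi)&=V_t(\varphi)+\mathrm{Var}_{\pi_{\epsilon_t}}(\varphi)&&\text{(resampling)}.\end{aligned}$$ \textbf{Theorem (Central Limit Theorem).} Let $t\ge1$. Assume that for every $1\le s\le t$: $c_{\epsilon_s}>0$; the acceptance probability of a trial from $\tilde\theta$ at time $s$ is positive for $\pi_{\epsilon_{s-1}}$-almost every $\tilde\theta$; and $\pi_{\epsilon_s}\ll h_s$. Let $\varphi:\Theta\times\mathcal X^n\to\mathbb R$ be such that $\varphi\in\mathcal F_t^{2+\zeta}$ for some $\zeta>0$, and let the constant function $1$ belong to $\mathcal F_t^{2+\zeta'}$ for some $\zeta'>0$. Then, in both cases (a) and (b), the particle system is almost surely well defined, $V_t(\varphi)<\infty$, and $$\sqrt N\big(\hat{\mathbb E}_t[\varphi]-\mathbb E_t[\varphi]\big)\xrightarrow{d}N(0,V_t(\varphi))\qquad(N\to\infty).$$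 -/

import Mathlib

open MeasureTheory ProbabilityTheory Filter Topology
open scoped ENNReal NNReal

namespace DPPF

noncomputable section

/-- Input of the differentially private particle filter. Databases are the points of `Fin n → 𝒳`;
`mech ε s x` is the mechanism density `m_ε (s ∣ x)` and `sdp` is the observed privatized statistic,
which is held fixed. The prior density and the densities of the perturbation kernels are taken with
respect to the reference measure `lam`. Kernels and budgets are used at times `t ≥ 1` only. -/
structure Input (Θ 𝒳 𝒮 : Type*) [MeasurableSpace Θ] [MeasurableSpace 𝒳] (n : ℕ) where
  lam : Measure Θ
  lam_sigmaFinite : SigmaFinite lam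
  priorDensity : Θ → ℝ≥0
  measurable_priorDensity : Measurable priorDensity
  lintegral_priorDensity : ∫⁻ θ, (priorDensity θ : ℝ≥0∞) ∂lam = 1
  f : Kernel Θ (Fin n → 𝒳)
  f_markov : IsMarkovKernel f
  mech : ℝ → 𝒮 → (Fin n → 𝒳) → ℝ≥0
  sdp : 𝒮
  eps : ℕ → ℝ
  measurable_mech : ∀ t, Measurable (mech (eps t) sdp)
  bddAbove_mech : ∀ t, BddAbove (Set.range (mech (eps t) sdp))
  K : ℕ → Kernel Θ Θ
  K_markov : ∀ t, IsMarkovKernel (K t)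
  K_absolutelyContinuous : ∀ t θ, K t θ ≪ lam

attribute [instance] Input.lam_sigmaFinite Input.f_markov Input.K_markov

/-- How the ancestors of the first iteration arise from the `N` i.i.d. draws from the prior: they
are these draws themselves, or a multinomial resample of them with equal weights. -/
inductive FirstStep
  | direct
  | resampled

namespace Input

variable {Θ 𝒳 𝒮 : Type*} [MeasurableSpace Θ] [MeasurableSpace 𝒳] {n : ℕ}
variable (D : Input Θ 𝒳 𝒮 n)

/-- The prior `π₀` as a measure on the parameter space. -/
def prior : Measure Θ := D.lam.withDensity (fun θ => (D.priorDensity θ : ℝ≥0∞))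

/-- The mechanism density `x ↦ m_{ε_t} (s_dp ∣ x)` at time `t`. -/
def mt (t : ℕ) (x : Fin n → 𝒳) : ℝ≥0 := D.mech (D.eps t) D.sdp x

/-- The acceptance probability `r_t(x) = m_{ε_t}(s_dp ∣ x) / sup_x m_{ε_t}(s_dp ∣ x)`. -/
def r (t : ℕ) (x : Fin n → 𝒳) : ℝ := D.mt t x / ((⨆ x', D.mt t x' : ℝ≥0) : ℝ)

/-! ### Target distributions -/

/-- The normalizing constant `c_{ε_t}(s_dp) = ∫∫ π₀(θ) f(x ∣ θ) m_{ε_t}(s_dp ∣ x) dx dθ`. -/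
def c (t : ℕ) : ℝ≥0∞ := ∫⁻ z, (D.mt t z.2 : ℝ≥0∞) ∂(D.prior ⊗ₘ D.f)

/-- The intermediate private posterior `π_{ε_t}(θ, x ∣ s_dp)`, for `t ≥ 1`: the joint law of
`(θ, x)` under prior and data model, reweighted by the mechanism density and normalized. -/
def posterior (t : ℕ) : Measure (Θ × (Fin n → 𝒳)) :=
  (D.c t)⁻¹ • (D.prior ⊗ₘ D.f).withDensity (fun z => (D.mt t z.2 : ℝ≥0∞))

/-- The marginal on `θ` of the time-`t` target: the prior at time `0`, and the marginal of
`π_{ε_t}` at later times. -/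
def target : ℕ → Measure Θ
  | 0 => D.prior
  | t + 1 => (D.posterior (t + 1)).map Prod.fst

/-! ### Propagation conditioned on acceptance -/

/-- One propagation trial from `θ'`: the law of `((θ, x), u)` with `θ ∼ K_t(θ', ·)`,
`x ∼ f(· ∣ θ)` and an independent `u ∼ U(0,1)`. -/
def trial (t : ℕ) : Kernel Θ ((Θ × (Fin n → 𝒳)) × ℝ) :=
  (D.K t ⊗ₖ Kernel.prodMkLeft Θ D.f) ×ₖ Kernel.const Θ (volume.restrict (Set.Ioo (0 : ℝ) 1))

/-- The acceptance event `A_t = {π₀(θ) > 0, r_t(x) > U}`. -/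
def A (t : ℕ) : Set ((Θ × (Fin n → 𝒳)) × ℝ) :=
  {p | 0 < D.priorDensity p.1.1 ∧ p.2 < D.r t p.1.2}

theorem measurable_r (t : ℕ) : Measurable (D.r t) := by
  have h : Measurable (D.mt t) := D.measurable_mech t
  unfold r
  fun_prop

theorem measurableSet_A (t : ℕ) : MeasurableSet (D.A t) := by
  have h1 := D.measurable_priorDensity
  have h2 := D.measurable_r t
  exact (measurableSet_lt measurable_const (h1.comp (measurable_fst.comp measurable_fst))).inter
    (measurableSet_lt measurable_snd (h2.comp (measurable_snd.comp measurable_fst)))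

/-- The propagation kernel `K_t(θ', · ∣ A_t)`: the law of `(θ, x)` in a trial from `θ'`, conditioned
on acceptance. This is the law of the first accepted pair when trials from `θ'` are repeated until
acceptance. -/
def KA (t : ℕ) : Kernel Θ (Θ × (Fin n → 𝒳)) where
  toFun θ' := (ProbabilityTheory.cond (D.trial t θ') (D.A t)).map Prod.fst
  measurable' := by
    refine Measure.measurable_of_measurable_coe _ fun s hs => ?_
    have hA := D.measurableSet_A t
    have h : ∀ θ', ((ProbabilityTheory.cond (D.trial t θ') (D.A t)).map Prod.fst) s
        = (D.trial t θ' (D.A t))⁻¹ * D.trial t θ' (D.A t ∩ Prod.fst ⁻¹' s) := fun θ' => by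
      rw [Measure.map_apply measurable_fst hs, cond_apply hA]
    simp_rw [h]
    exact ((D.trial t).measurable_coe hA).inv.mul
      ((D.trial t).measurable_coe (hA.inter (measurable_fst hs)))

/-- The law `h_t = ∫ π_{ε_{t-1}}(dθ') K_t(θ', · ∣ A_t)` of a propagated particle, for `t ≥ 1`. -/
def h (t : ℕ) : Measure (Θ × (Fin n → 𝒳)) := (D.target (t - 1)).bind (D.KA t)

/-- The importance weight `w_t = π_{ε_t} / h_t`, the density ratio of the target and the
proposal. -/
def w (t : ℕ) (z : Θ × (Fin n → 𝒳)) : ℝ := ((D.posterior t).rnDeriv (D.h t) z).toReal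

/-- The conditional expectation `θ' ↦ E_{K_t(θ', · ∣ A_t)}[ψ]`. -/
def condMean (t : ℕ) (ψ : Θ × (Fin n → 𝒳) → ℝ) (θ' : Θ) : ℝ := ∫ z, ψ z ∂(D.KA t θ')

/-! ### The particle system -/

/-- The normalized importance weights of `N` particles at time `t`. -/
def normWeight (t : ℕ) {N : ℕ} (y : Fin N → Θ × (Fin n → 𝒳)) (j : Fin N) : ℝ :=
  D.w t (y j) / ∑ i, D.w t (y i)

/-- Multinomial resampling: given the parameters `θ₁, …, θ_N` and the weights `W₁, …, W_N`, the law
of `N` independent draws from `∑ j, W_j δ_{θ_j}`. -/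
def resample {N : ℕ} (θ : Fin N → Θ) (W : Fin N → ℝ) : Measure (Fin N → Θ) :=
  Measure.pi fun _ => ∑ j, ENNReal.ofReal (W j) • Measure.dirac (θ j)

/-- Propagation: given the ancestors, the new particles are drawn independently, the `i`-th one from
`K_t(θ_i, · ∣ A_t)`. -/
def propagate (t : ℕ) {N : ℕ} (θ : Fin N → Θ) : Measure (Fin N → Θ × (Fin n → 𝒳)) :=
  Measure.pi fun i => D.KA t (θ i)

/-- The joint law of the `N` ancestors of the first iteration. -/
def initialLaw (N : ℕ) : FirstStep → Measure (Fin N → Θ)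
  | .direct => Measure.pi fun _ => D.prior
  | .resampled => (Measure.pi fun _ => D.prior).bind fun θ => resample θ fun _ => 1 / (N : ℝ)

/-- The joint law of the `N` ancestors that are used in iteration `t + 1`: they are resampled from
the weighted particles of iteration `t`. -/
def ancestorLaw (σ : FirstStep) (N : ℕ) : ℕ → Measure (Fin N → Θ)
  | 0 => D.initialLaw N σ
  | t + 1 => ((ancestorLaw σ N t).bind (D.propagate (t + 1))).bind
      fun y => resample (fun j => (y j).1) (D.normWeight (t + 1) y)

/-- The joint law of the `N` accepted particles `(θ, x)^{(i,t)}` of iteration `t ≥ 1`. -/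
def particleLaw (σ : FirstStep) (N t : ℕ) : Measure (Fin N → Θ × (Fin n → 𝒳)) :=
  (D.ancestorLaw σ N (t - 1)).bind (D.propagate t)

/-- The estimator `Ê_t[φ] = ∑ i, W^{(i,t)} φ((θ, x)^{(i,t)})`. -/
def estimator (t : ℕ) (φ : Θ × (Fin n → 𝒳) → ℝ) {N : ℕ}
    (y : Fin N → Θ × (Fin n → 𝒳)) : ℝ :=
  ∑ i, D.normWeight t y i * φ (y i)

/-- The posterior expectation `E_t[φ]`. -/
def postMean (t : ℕ) (φ : Θ × (Fin n → 𝒳) → ℝ) : ℝ := ∫ z, φ z ∂(D.posterior t)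

/-! ### Recursive measurability -/

/-- The classes `F_t^p` of functions of the parameter alone. At time `0` the condition is
`E_{π₀}|g|^p < ∞`. -/
def MemFParam (p : ℝ) : ℕ → (Θ → ℝ) → Prop
  | 0, g => Measurable g ∧ MemLp g (ENNReal.ofReal p) D.prior
  | t + 1, g => Measurable g ∧
      MemLp (fun z => D.w (t + 1) z * g z.1) (ENNReal.ofReal p) (D.h (t + 1)) ∧
      MemFParam p t (D.condMean (t + 1) fun z => D.w (t + 1) z * g z.1)

/-- The class `F_t^p`, for `t ≥ 1`: the measurable `φ` with `E_{h_t}|w_t φ|^p < ∞` such that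
`θ' ↦ E_{K_t(θ', · ∣ A_t)}[w_t φ]` belongs to `F_{t-1}^p`. -/
def MemF (p : ℝ) (t : ℕ) (φ : Θ × (Fin n → 𝒳) → ℝ) : Prop :=
  Measurable φ ∧ MemLp (fun z => D.w t z * φ z) (ENNReal.ofReal p) (D.h t) ∧
    D.MemFParam p (t - 1) (D.condMean t fun z => D.w t z * φ z)

/-! ### Asymptotic variances -/

/-- Propagation: `V̌_t(ψ) = Ṽ_{t-1}(E_{K_t(·,· ∣ A_t)} ψ) + E_{π_{ε_{t-1}}}[Var_{K_t(·,· ∣ A_t)} ψ]`,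
where `prev` is `Ṽ_{t-1}`. -/
def propVar (prev : (Θ → ℝ) → ℝ≥0∞) (t : ℕ) (ψ : Θ × (Fin n → 𝒳) → ℝ) : ℝ≥0∞ :=
  prev (D.condMean t ψ) + ∫⁻ θ', evariance ψ (D.KA t θ') ∂(D.target (t - 1))

/-- Reweighting: `V_t(φ) = V̌_t(w_t (φ - E_{π_{ε_t}} φ))`, where `prev` is `Ṽ_{t-1}`. -/
def reweightVar (prev : (Θ → ℝ) → ℝ≥0∞) (t : ℕ) (φ : Θ × (Fin n → 𝒳) → ℝ) : ℝ≥0∞ :=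
  D.propVar prev t fun z => D.w t z * (φ z - D.postMean t φ)

/-- Resampling: `Ṽ_t(g) = V_t(g) + Var_{π_{ε_t}}(g)` for `t ≥ 1`. At time `0`, with
`V_0 = Var_{π₀}`: if the initial draws are used directly then `Ṽ_0 = V_0`, and if they are
resampled then `Ṽ_0 = V_0 + Var_{π₀}`. -/
def resampleVar (σ : FirstStep) : ℕ → (Θ → ℝ) → ℝ≥0∞
  | 0, g => match σ with
    | .direct => evariance g D.prior
    | .resampled => evariance g D.prior + evariance g D.prior
  | t + 1, g => D.reweightVar (resampleVar σ t) (t + 1) (fun z => g z.1) +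
      evariance (fun z => g z.1) (D.posterior (t + 1))

/-- The asymptotic variance `V_t(φ)`, for `t ≥ 1`. -/
def asympVar (σ : FirstStep) (t : ℕ) (φ : Θ × (Fin n → 𝒳) → ℝ) : ℝ≥0∞ :=
  D.reweightVar (D.resampleVar σ (t - 1)) t φ

end Input

end

end DPPF

/-! Every random step of the filter draws `N` points that are independent given the past, from
random measures whose averages converge to a known law. Given the past, the characteristic function
of the normalized sum is, up to a Lyapunov error, a phase carrying the conditional mean times a
Gaussian factor carrying the averaged conditional variance. A law of large numbers makes the
Gaussian factor deterministic in the limit, so it leaves the expectation, and the phase is governed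
by the CLT of the preceding step. Hence the two variances add. This is
`IsPropagation.asymptoticNormal`; together with the law of large numbers
`IsPropagation.isConsistent` it serves the initial draws, propagation and resampling alike.

Reweighting brings no new randomness: the total weight divided by `N` tends to 1, and Slutsky's
lemma (`AsymptoticNormal.mul`) removes the normalization.

Three points close the induction in `AncestorCLT.succ`. The law of large numbers holds for all
integrable functions, so it covers conditional variances and p-th moments. An accepted pair has
positive prior and mechanism densities, so `h_t` and the posterior are equivalent, and the weights
of all particles are almost surely positive. Finally, the induction concerns centred functions only,
and centring survives both conditional expectation and reweighting; the constant function 1 matters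
only when `φ` itself is centred at the last time. -/

namespace DPPF

/-! ### Convergence in probability and in law on varying probability spaces; Slutsky's lemma -/

section Convergence

variable {Ω : ℕ → Type*} [∀ N, MeasurableSpace (Ω N)] {P : ∀ N, Measure (Ω N)}

/-- Convergence in probability to a constant of random variables defined on varying spaces. -/
def TendstoInProb (P : ∀ N, Measure (Ω N)) (X : ∀ N, Ω N → ℝ) (c : ℝ) : Prop :=
  ∀ ε : ℝ, 0 < ε → Tendsto (fun N => P N {ω | ε ≤ |X N ω - c|}) atTop (𝓝 0)

/-- Convergence in law to `N(0, V)` of random variables defined on varying spaces, expressed through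
characteristic functions. -/
def AsymptoticNormal (P : ∀ N, Measure (Ω N)) (X : ∀ N, Ω N → ℝ) (V : ℝ) : Prop :=
  ∀ u : ℝ, Tendsto (fun N => ∫ ω, Complex.exp ((u * X N ω : ℝ) * Complex.I) ∂P N) atTop
    (𝓝 (Complex.exp ((-(u ^ 2 * V / 2) : ℝ) : ℂ)))

theorem TendstoInProb.of_le {X Y : ∀ N, Ω N → ℝ} {c d : ℝ} (hY : TendstoInProb P Y d)
    (h : ∀ᶠ N in atTop, ∀ᵐ ω ∂P N, |X N ω - c| ≤ |Y N ω - d|) : TendstoInProb P X c := by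
  intro ε hε
  refine tendsto_of_tendsto_of_tendsto_of_le_of_le' tendsto_const_nhds (hY ε hε)
    (Eventually.of_forall fun _ => zero_le) ?_
  filter_upwards [h] with N hN
  refine measure_mono_ae ?_
  filter_upwards [hN] with ω hω (h' : ε ≤ _)
  exact h'.trans hω

theorem TendstoInProb.congr {X Y : ∀ N, Ω N → ℝ} {c : ℝ} (hY : TendstoInProb P Y c)
    (h : ∀ᶠ N in atTop, ∀ᵐ ω ∂P N, X N ω = Y N ω) : TendstoInProb P X c := by
  refine hY.of_le ?_
  filter_upwards [h] with N hN
  filter_upwards [hN] with ω hω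
  rw [hω]

theorem TendstoInProb.of_tendsto {a : ℕ → ℝ} {c : ℝ} [∀ N, IsProbabilityMeasure (P N)]
    (h : Tendsto a atTop (𝓝 c)) : TendstoInProb P (fun N _ => a N) c := by
  intro ε hε
  refine tendsto_const_nhds.congr' ?_
  filter_upwards [Metric.tendsto_nhds.1 h ε hε] with N hN
  rw [Real.dist_eq] at hN
  simp [not_le.2 hN]

theorem TendstoInProb.map₂ {X Y : ∀ N, Ω N → ℝ} {a b : ℝ} {F : ℝ → ℝ → ℝ}
    (hX : TendstoInProb P X a) (hY : TendstoInProb P Y b)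
    (hF : ContinuousAt (fun p : ℝ × ℝ => F p.1 p.2) (a, b)) :
    TendstoInProb P (fun N ω => F (X N ω) (Y N ω)) (F a b) := by
  intro ε hε
  obtain ⟨δ, hδ, h⟩ := Metric.continuousAt_iff.1 hF ε hε
  have h0 : Tendsto (fun N => P N {ω | δ ≤ |X N ω - a|} + P N {ω | δ ≤ |Y N ω - b|}) atTop
      (𝓝 0) := by simpa using (hX δ hδ).add (hY δ hδ)
  refine tendsto_of_tendsto_of_tendsto_of_le_of_le tendsto_const_nhds h0
    (fun _ => zero_le) fun N => ?_
  refine (measure_mono ?_).trans (measure_union_le _ _)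
  intro ω hω
  by_contra hcon
  simp only [Set.mem_union, Set.mem_ofPred_eq, not_or, not_le] at hcon hω
  have := h (x := (X N ω, Y N ω)) (by
    rw [Prod.dist_eq, Real.dist_eq, Real.dist_eq]; exact max_lt hcon.1 hcon.2)
  rw [Real.dist_eq] at this
  exact absurd hω (not_le.2 this)

/-- The form suited to truncation: a compact set or an approximating function is fixed in terms of
`a`, and only then does `N` tend to infinity. -/
theorem tendsto_zero_of_forall_le_add {x : ℕ → ℝ≥0∞}
    (h : ∀ a : ℝ, 0 < a → ∃ F : ℕ → ℝ≥0∞, Tendsto F atTop (𝓝 0) ∧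
      ∀ᶠ N in atTop, x N ≤ ENNReal.ofReal a + F N) : Tendsto x atTop (𝓝 0) := by
  rw [ENNReal.tendsto_nhds_zero]
  intro ε hε
  rcases eq_or_ne ε ∞ with rfl | htop
  · simp
  obtain ⟨F, hF, h'⟩ := h (ε.toReal / 2) (half_pos (ENNReal.toReal_pos hε.ne' htop))
  have h2 : 0 < ENNReal.ofReal (ε.toReal / 2) := by
    simpa using half_pos (ENNReal.toReal_pos hε.ne' htop)
  filter_upwards [h', ENNReal.tendsto_nhds_zero.1 hF _ h2] with N h3 h4
  calc x N ≤ _ := h3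
    _ ≤ ENNReal.ofReal (ε.toReal / 2) + ENNReal.ofReal (ε.toReal / 2) := by gcongr
    _ = ε := by
      rw [← ENNReal.ofReal_add (by positivity) (by positivity), add_halves,
        ENNReal.ofReal_toReal htop]

/-- Bounded convergence without a common probability space: where `|R|` is at least `a` the bound
`B` is used, elsewhere the integrand is at most `a`. -/
theorem TendstoInProb.tendsto_lintegral {R : ∀ N, Ω N → ℝ} (hR : TendstoInProb P R 0)
    [∀ N, IsProbabilityMeasure (P N)] {Z : ∀ N, Ω N → ℝ≥0∞} {B : ℝ≥0∞} (hB : B ≠ ∞)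
    (hZB : ∀ N, ∀ᵐ ω ∂P N, Z N ω ≤ B) (h : ∀ᶠ N in atTop, ∀ᵐ ω ∂P N, Z N ω ≤ ENNReal.ofReal (R N ω)) :
    Tendsto (fun N => ∫⁻ ω, Z N ω ∂P N) atTop (𝓝 0) := by
  refine tendsto_zero_of_forall_le_add fun a ha => ⟨fun N => B * P N {ω | a ≤ |R N ω - 0|},
    by simpa using ENNReal.Tendsto.const_mul (hR a ha) (Or.inr hB), ?_⟩
  filter_upwards [h] with N hN
  calc ∫⁻ ω, Z N ω ∂P N
      ≤ ∫⁻ ω, ENNReal.ofReal a + {ω | a ≤ |R N ω - 0|}.indicator (fun _ => B) ω ∂P N := by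
        refine lintegral_mono_ae ?_
        filter_upwards [hN, hZB N] with ω hω hBω
        by_cases hc : a ≤ |R N ω - 0|
        · simp only [Set.indicator, Set.mem_ofPred_eq, hc, if_true]
          exact hBω.trans le_add_self
        · refine hω.trans (le_add_right (ENNReal.ofReal_le_ofReal ?_))
          rw [sub_zero, not_le] at hc
          exact (le_abs_self _).trans hc.le
    _ = ENNReal.ofReal a + ∫⁻ ω, {ω | a ≤ |R N ω - 0|}.indicator (fun _ => B) ω ∂P N := by
        rw [lintegral_add_left measurable_const]; simp
    _ ≤ _ := by gcongr; exact lintegral_indicator_const_le _ _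

theorem TendstoInProb.tendsto_integral {R : ∀ N, Ω N → ℝ} (hR : TendstoInProb P R 0)
    [∀ N, IsProbabilityMeasure (P N)] {Z : ∀ N, Ω N → ℂ} {B : ℝ}
    (hZB : ∀ N, ∀ᵐ ω ∂P N, ‖Z N ω‖ ≤ B) (h : ∀ᶠ N in atTop, ∀ᵐ ω ∂P N, ‖Z N ω‖ ≤ R N ω) :
    Tendsto (fun N => ∫ ω, Z N ω ∂P N) atTop (𝓝 0) := by
  have h1 := hR.tendsto_lintegral (Z := fun N ω => ENNReal.ofReal ‖Z N ω‖)
    (B := ENNReal.ofReal B) ENNReal.ofReal_ne_top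
    (fun N => (hZB N).mono fun ω hω => ENNReal.ofReal_le_ofReal hω)
    (by filter_upwards [h] with N hN
        filter_upwards [hN] with ω hω
        exact ENNReal.ofReal_le_ofReal hω)
  have h2 := (ENNReal.tendsto_toReal (by simp)).comp h1
  exact squeeze_zero_norm (fun N => norm_integral_le_lintegral_norm _) (by simpa [Function.comp_def] using h2)

theorem norm_exp_mul_I_sub_le (x y : ℝ) :
    ‖Complex.exp (x * Complex.I) - Complex.exp (y * Complex.I)‖ ≤ |x - y| := by
  have h : Complex.exp (x * Complex.I) - Complex.exp (y * Complex.I)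
      = Complex.exp (y * Complex.I) * (Complex.exp (Complex.I * ((x - y : ℝ) : ℂ)) - 1) := by
    rw [mul_sub, ← Complex.exp_add, mul_one]; congr 2; push_cast; ring
  rw [h, norm_mul, Complex.norm_exp_ofReal_mul_I, one_mul]
  exact Real.norm_exp_I_mul_ofReal_sub_one_le

/-- The integrands of the two characteristic functions differ by at most 2 and by at most `|u (Y -
X)|`, so bounded convergence applies. -/
theorem AsymptoticNormal.of_sub {X Y : ∀ N, Ω N → ℝ} {V : ℝ} [∀ N, IsProbabilityMeasure (P N)]
    (hX : AsymptoticNormal P X V) (hXm : ∀ N, Measurable (X N)) (hYm : ∀ N, Measurable (Y N))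
    (h : TendstoInProb P (fun N ω => Y N ω - X N ω) 0) : AsymptoticNormal P Y V := by
  intro u
  have hR : TendstoInProb P (fun N ω => |u * (Y N ω - X N ω)|) 0 := by
    have := h.map₂ h (F := fun x _ => |u * x|) (by fun_prop)
    simpa using this
  have h1 := hR.tendsto_integral (B := 2)
    (Z := fun N ω => Complex.exp ((u * Y N ω : ℝ) * Complex.I)
      - Complex.exp ((u * X N ω : ℝ) * Complex.I)) (fun N => ae_of_all _ fun ω => by
      refine (norm_sub_le _ _).trans ?_
      rw [Complex.norm_exp_ofReal_mul_I, Complex.norm_exp_ofReal_mul_I]; norm_num)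
    (Eventually.of_forall fun N => ae_of_all _ fun ω => by
      refine (norm_exp_mul_I_sub_le _ _).trans_eq ?_
      rw [mul_sub])
  have hint : ∀ (W : ∀ N, Ω N → ℝ) (_ : ∀ N, Measurable (W N)) N,
      Integrable (fun ω => Complex.exp ((u * W N ω : ℝ) * Complex.I)) (P N) := fun W hW N => by
    have := hW N
    refine Integrable.of_bound (C := 1) (by fun_prop) (ae_of_all _ fun ω => ?_)
    rw [Complex.norm_exp_ofReal_mul_I]
  have h2 := h1.add (hX u)
  rw [zero_add] at h2
  refine h2.congr fun N => ?_
  rw [integral_sub (hint Y hYm N) (hint X hXm N)]; ring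

theorem AsymptoticNormal.tendsto_charFun {X : ∀ N, Ω N → ℝ} {V : ℝ≥0}
    (hX : AsymptoticNormal P X V) (hXm : ∀ N, Measurable (X N)) (u : ℝ) :
    Tendsto (fun N => charFun ((P N).map (X N)) u) atTop (𝓝 (charFun (gaussianReal 0 V) u)) := by
  have h := hX u
  rw [charFun_gaussianReal]
  convert h using 2 with N
  · rw [charFun_apply_real, integral_map (hXm N).aemeasurable (by fun_prop)]
    simp
  · push_cast; congr 1; ring

theorem AsymptoticNormal.mul {X Y : ∀ N, Ω N → ℝ} {V : ℝ} (hV : 0 ≤ V)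
    [∀ N, IsProbabilityMeasure (P N)]
    (hX : AsymptoticNormal P X V) (hXm : ∀ N, Measurable (X N)) (hYm : ∀ N, Measurable (Y N))
    (h : TendstoInProb P Y 1) : AsymptoticNormal P (fun N ω => X N ω * Y N ω) V := by
  lift V to ℝ≥0 using hV
  refine hX.of_sub hXm (fun N => (hXm N).mul (hYm N)) fun ε hε => ?_
  have hprob : ∀ N, IsProbabilityMeasure ((P N).map (X N)) := fun N =>
    Measure.isProbabilityMeasure_map (hXm N).aemeasurable
  -- Convergence to a continuous characteristic function gives tightness, so `X` is bounded by a
  -- constant up to probability `a`, and `X (Y - 1)` is small with `Y - 1`.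
  have ht := isTightMeasureSet_of_tendsto_charFun (by fun_prop)
    (hX.tendsto_charFun hXm)
  rw [isTightMeasureSet_iff_exists_isCompact_measure_compl_le] at ht
  refine tendsto_zero_of_forall_le_add fun a ha => ?_
  obtain ⟨K, hK, hK'⟩ := ht (ENNReal.ofReal a) (by simpa using ha)
  obtain ⟨M, hM⟩ := hK.isBounded.subset_closedBall 0
  set M' := max M 1
  have hM' : 0 < M' := lt_of_lt_of_le one_pos (le_max_right _ _)
  refine ⟨_, h (ε / M') (by positivity), Eventually.of_forall fun N => ?_⟩
  have hb : P N {ω | M' < |X N ω|} ≤ ENNReal.ofReal a := by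
    refine le_trans ?_ (hK' _ ⟨N, rfl⟩)
    rw [Measure.map_apply (hXm N) hK.measurableSet.compl]
    refine measure_mono fun ω hω hmem => ?_
    have := hM hmem
    rw [mem_closedBall_zero_iff, Real.norm_eq_abs] at this
    exact absurd ((this.trans (le_max_left _ _)).trans_lt hω) (lt_irrefl _)
  refine (measure_mono ?_).trans ((measure_union_le _ _).trans (add_le_add_left hb _))
  intro ω hω
  by_contra hcon
  simp only [Set.mem_union, Set.mem_ofPred_eq, not_or, not_le, not_lt] at hcon hω
  rw [sub_zero, show X N ω * Y N ω - X N ω = X N ω * (Y N ω - 1) by ring, abs_mul] at hω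
  have : |X N ω| * |Y N ω - 1| < M' * (ε / M') :=
    mul_lt_mul' hcon.1 hcon.2 (abs_nonneg _) hM'
  rw [mul_div_cancel₀ _ hM'.ne'] at this
  linarith

end Convergence

/-! ### Conditionally independent sampling and its law of large numbers -/

section Propagation

theorem measurable_measure_pi {ι Ω E : Type*} [Fintype ι] [MeasurableSpace Ω] [MeasurableSpace E]
    {κ : ι → Ω → Measure E} (hκ : ∀ i, Measurable (κ i)) (hfin : ∀ i ω, IsFiniteMeasure (κ i ω)) :
    Measurable fun ω => Measure.pi fun i => κ i ω := by
  have := hfin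
  refine Measurable.measure_of_isPiSystem generateFrom_pi.symm isPiSystem_pi ?_ ?_
  · rintro _ ⟨s, hs, rfl⟩
    simp_rw [Measure.pi_pi]
    exact Finset.measurable_prod _ fun i _ =>
      (Measure.measurable_coe (hs i (Set.mem_univ i))).comp (hκ i)
  · simp_rw [Measure.pi_univ]
    exact Finset.measurable_prod _ fun i _ =>
      (Measure.measurable_coe MeasurableSet.univ).comp (hκ i)

theorem measurable_integral_measure {Ω E : Type*} [MeasurableSpace Ω] [MeasurableSpace E]
    {κ : Ω → Measure E} (hκ : Measurable κ) {ψ : E → ℝ} (hψ : Measurable ψ) :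
    Measurable fun ω => ∫ z, ψ z ∂κ ω :=
  (hψ.stronglyMeasurable.integral_kernel (κ := ⟨κ, hκ⟩)).measurable

theorem integral_bind {Ω E F : Type*} [MeasurableSpace Ω] [MeasurableSpace E]
    [NormedAddCommGroup F] [NormedSpace ℝ F] {μ : Measure Ω}
    {κ : Ω → Measure E} (hκ : Measurable κ) {f : E → F} (hf : Integrable f (μ.bind κ)) :
    ∫ z, f z ∂(μ.bind κ) = ∫ ω, ∫ z, f z ∂κ ω ∂μ := by
  have h : μ.bind κ = ((⟨κ, hκ⟩ : Kernel Ω E) ∘ₖ Kernel.const Unit μ) () :=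
    Measure.comp_eq_comp_const_apply (κ := ⟨κ, hκ⟩)
  rw [h] at hf ⊢
  rw [Kernel.integral_comp hf]; rfl

theorem integrable_bind_iff {Ω E : Type*} [MeasurableSpace Ω] [MeasurableSpace E] {μ : Measure Ω}
    {κ : Ω → Measure E} (hκ : Measurable κ) {f : E → ℝ} (hf : Measurable f) :
    Integrable f (μ.bind κ) ↔ (∀ᵐ ω ∂μ, Integrable f (κ ω)) ∧
      Integrable (fun ω => ∫ z, ‖f z‖ ∂κ ω) μ :=
  Measure.integrable_comp_iff (κ := ⟨κ, hκ⟩) hf.aestronglyMeasurable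

/-- Deviation of an empirical mean of independent variables, for a function `ψ` that is close to a
bounded function `g`. -/
theorem pi_deviation_le {E : Type*} [MeasurableSpace E] {N : ℕ} (hN : 0 < N)
    (ν : Fin N → Measure E) [∀ i, IsProbabilityMeasure (ν i)] {ψ g : E → ℝ} (hg : Measurable g)
    (hψi : ∀ i, Integrable ψ (ν i)) {C ε : ℝ} (hε : 0 < ε) (hC : ∀ z, ‖g z‖ ≤ C) :
    Measure.pi ν {y | 2 * ε ≤ |(∑ i, ψ (y i)) / N - (∑ i, ∫ z, g z ∂ν i) / N|} ≤
      ENNReal.ofReal (C ^ 2 / (N * ε ^ 2)) +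
      ENNReal.ofReal ((∑ i, ∫ z, |ψ z - g z| ∂ν i) / N / ε) := by
  have hN' : (0 : ℝ) < N := by exact_mod_cast hN
  have hgL : ∀ i, MemLp g 2 (ν i) := fun i => MemLp.of_bound hg.aestronglyMeasurable C (ae_of_all _ hC)
  have hgi : ∀ i, Integrable g (ν i) := fun i => (hgL i).integrable one_le_two
  -- One `ε` is spent on the bounded `g`, controlled by Chebyshev with total variance at most `N * C
  -- ^ 2`; the other on `ψ - g`, controlled by Markov.
  have hsub : {y : Fin N → E | 2 * ε ≤ |(∑ i, ψ (y i)) / N - (∑ i, ∫ z, g z ∂ν i) / N|} ⊆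
      {y | ε * N ≤ |(∑ i, fun y : Fin N → E => g (y i)) y
        - ∫ y, (∑ i, fun y : Fin N → E => g (y i)) y ∂Measure.pi ν|} ∪
      {y | ε ≤ (∑ i, |ψ (y i) - g (y i)|) / N} := by
    intro y hy
    by_contra hcon
    simp only [Set.mem_union, Set.mem_ofPred_eq, not_or, not_le] at hcon hy
    obtain ⟨h1, h2⟩ := hcon
    simp only [Finset.sum_apply] at h1
    rw [integral_finsetSum _ fun i _ => integrable_comp_eval (hgi i)] at h1
    have h0 : ∀ i, ∫ y : Fin N → E, g (y i) ∂Measure.pi ν = ∫ z, g z ∂ν i :=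
      fun i => integral_comp_eval hg.aestronglyMeasurable
    simp_rw [h0] at h1
    have h3 : |(∑ i, ψ (y i)) / N - (∑ i, g (y i)) / N| ≤ (∑ i, |ψ (y i) - g (y i)|) / N := by
      rw [← sub_div, abs_div, abs_of_pos hN', ← Finset.sum_sub_distrib]
      gcongr
      exact Finset.abs_sum_le_sum_abs _ _
    have h4 : |(∑ i, g (y i)) / N - (∑ i, ∫ z, g z ∂ν i) / N| < ε := by
      rwa [← sub_div, abs_div, abs_of_pos hN', div_lt_iff₀ hN']
    have := abs_sub_le ((∑ i, ψ (y i)) / N) ((∑ i, g (y i)) / N) ((∑ i, ∫ z, g z ∂ν i) / N)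
    linarith
  refine (measure_mono hsub).trans ((measure_union_le _ _).trans (add_le_add ?_ ?_))
  · have hL : MemLp (∑ i, fun y : Fin N → E => g (y i)) 2 (Measure.pi ν) := by
      refine memLp_finsetSum' _ fun i _ => ?_
      exact MemLp.of_bound (hg.comp (measurable_pi_apply i)).aestronglyMeasurable C (ae_of_all _ fun y => hC _)
    refine (meas_ge_le_variance_div_sq hL (by positivity)).trans (ENNReal.ofReal_le_ofReal ?_)
    rw [variance_sum_pi (X := fun _ => g) hgL]
    have hv : ∑ i, Var[g; ν i] ≤ N * C ^ 2 := by
      calc ∑ i, Var[g; ν i] ≤ ∑ _i : Fin N, C ^ 2 := Finset.sum_le_sum fun i _ => by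
            have := variance_le_sq_of_bounded (μ := ν i) (a := -C) (b := C) (X := g)
              (ae_of_all _ fun z => abs_le.1 (hC z)) hg.aemeasurable
            rwa [show ((C - -C) / 2) ^ 2 = C ^ 2 by ring] at this
        _ = N * C ^ 2 := by simp
    rw [div_le_div_iff₀ (by positivity) (by positivity)]
    calc (∑ i, Var[g; ν i]) * (N * ε ^ 2) ≤ (N * C ^ 2) * (N * ε ^ 2) := by gcongr
      _ = C ^ 2 * (ε * N) ^ 2 := by ring
  · have hi : ∀ i, Integrable (fun z => |ψ z - g z|) (ν i) := fun i => ((hψi i).sub (hgi i)).abs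
    have hI : Integrable (fun y : Fin N → E => (∑ i, |ψ (y i) - g (y i)|) / N) (Measure.pi ν) :=
      (integrable_finsetSum _ fun i _ => integrable_comp_eval
        (μ := ν) (i := i) (f := fun z => |ψ z - g z|) (hi i)).div_const _
    have h1 := mul_meas_ge_le_integral_of_nonneg (μ := Measure.pi ν) (ae_of_all _ fun y => by
      simp only [Pi.zero_apply]; positivity) hI ε
    rw [integral_div, integral_finsetSum _ fun i _ => integrable_comp_eval
        (μ := ν) (i := i) (f := fun z => |ψ z - g z|) (hi i)] at h1
    have h2 : ∀ i, ∫ y : Fin N → E, |ψ (y i) - g (y i)| ∂Measure.pi ν = ∫ z, |ψ z - g z| ∂ν i :=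
      fun i => integral_comp_eval (μ := ν) (i := i) (f := fun z => |ψ z - g z|) (hi i).aestronglyMeasurable
    simp_rw [h2] at h1
    rw [← ofReal_measureReal (measure_ne_top _ _)]
    refine ENNReal.ofReal_le_ofReal ?_
    rwa [le_div_iff₀ hε, mul_comm]

variable {Ω : ℕ → Type*} [∀ N, MeasurableSpace (Ω N)] {P : ∀ N, Measure (Ω N)}
variable {E : Type*} [MeasurableSpace E] {κ : ∀ N, Fin N → Ω N → Measure E} {ν : Measure E}

/-- Given `ω` with law `P N`, the law of `N` independent draws from `κ N i ω`. -/
noncomputable def propagated (P : ∀ N, Measure (Ω N)) (κ : ∀ N, Fin N → Ω N → Measure E) (N : ℕ) :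
    Measure (Fin N → E) :=
  (P N).bind fun ω => Measure.pi fun i => κ N i ω

/-- The random measures `κ N i ω` are almost surely probability measures, and their averages
converge to `ν` in probability, on integrable functions. -/
structure IsPropagation (P : ∀ N, Measure (Ω N)) (κ : ∀ N, Fin N → Ω N → Measure E)
    (ν : Measure E) : Prop where
  measurable : ∀ N i, Measurable (κ N i)
  isFinite : ∀ N i ω, IsFiniteMeasure (κ N i ω)
  isProb : ∀ N, ∀ᵐ ω ∂P N, ∀ i, IsProbabilityMeasure (κ N i ω)
  ac : ∀ s, MeasurableSet s → ν s = 0 → ∀ N, ∀ᵐ ω ∂P N, ∀ i, κ N i ω s = 0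
  integrable : ∀ ψ : E → ℝ, Measurable ψ → Integrable ψ ν →
    ∀ N, ∀ᵐ ω ∂P N, ∀ i, Integrable ψ (κ N i ω)
  tendsto : ∀ ψ : E → ℝ, Measurable ψ → Integrable ψ ν →
    TendstoInProb P (fun N ω => (∑ i, ∫ z, ψ z ∂κ N i ω) / N) (∫ z, ψ z ∂ν)

/-- The empirical measures of particle systems with laws `P N` converge to `ν` in probability, on
integrable functions, and almost surely no particle lies in a given `ν`-null set. -/
structure IsConsistent (P : ∀ N, Measure (Fin N → E)) (ν : Measure E) : Prop where
  ac : ∀ s, MeasurableSet s → ν s = 0 → ∀ N, ∀ᵐ y ∂P N, ∀ i, y i ∉ s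
  tendsto : ∀ ψ : E → ℝ, Measurable ψ → Integrable ψ ν →
    TendstoInProb P (fun N y => (∑ i, ψ (y i)) / N) (∫ z, ψ z ∂ν)

theorem IsConsistent.ae {P : ∀ N, Measure (Fin N → E)} (h : IsConsistent P ν) {p : E → Prop}
    (hp : ∀ᵐ z ∂ν, p z) (N : ℕ) : ∀ᵐ y ∂P N, ∀ i, p (y i) := by
  obtain ⟨t, ht, htm, ht0⟩ := exists_measurable_superset_of_null hp
  filter_upwards [h.ac t htm ht0 N] with y hy i
  by_contra hcon
  exact hy i (ht hcon)

variable (h : IsPropagation P κ ν)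
include h

theorem IsPropagation.measurable_pi (N : ℕ) :
    Measurable fun ω => Measure.pi fun i => κ N i ω :=
  measurable_measure_pi (h.measurable N) (h.isFinite N)

theorem IsPropagation.isProbabilityMeasure [∀ N, IsProbabilityMeasure (P N)] (N : ℕ) :
    IsProbabilityMeasure (propagated P κ N) := by
  refine isProbabilityMeasure_bind (h.measurable_pi N).aemeasurable ?_
  filter_upwards [h.isProb N] with ω hω
  infer_instance

/-- Second moments are not available, so `ψ` is replaced by a simple function `g` close to it in
`L¹(ν)`. The averaged conditional means of `|ψ - g|` converge to its small `ν`-integral, which makes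
the Markov term of `pi_deviation_le` small. -/
theorem IsPropagation.isConsistent [∀ N, IsProbabilityMeasure (P N)] :
    IsConsistent (propagated P κ) ν where
  ac s hs hs0 N := by
    have hm : MeasurableSet {y : Fin N → E | ∀ i, y i ∉ s} := by
      have : {y : Fin N → E | ∀ i, y i ∉ s} = ⋂ i, (fun y : Fin N → E => y i) ⁻¹' sᶜ := by
        ext; simp
      rw [this]
      exact MeasurableSet.iInter fun i => measurable_pi_apply i hs.compl
    refine Measure.ae_comp_of_ae_ae (κ := ⟨_, h.measurable_pi N⟩) hm ?_
    filter_upwards [h.ac s hs hs0 N] with ω hω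
    have := h.isFinite N
    refine ae_all_iff.2 fun i => ?_
    change ∀ᵐ y ∂Measure.pi fun i => κ N i ω, y i ∉ s
    refine (Measure.tendsto_eval_ae_ae (μ := fun i => κ N i ω) (i := i)).eventually
      (p := fun z => z ∉ s) ?_
    exact measure_eq_zero_iff_ae_notMem.1 (hω i)
  tendsto ψ hψ hψi ε hε := by
    refine tendsto_zero_of_forall_le_add fun a ha => ?_
    -- The bound `ε / 4` pays for replacing the limit of `ψ` by that of `g`. Off `S2` the average of
    -- `|ψ - g|` is below `2 * δ`, and Markov divides it by `ε / 4`, hence `a * ε / 8`.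
    set δ := min (ε / 4) (a * ε / 8)
    have hδ : 0 < δ := lt_min (by positivity) (by positivity)
    obtain ⟨g, hgδ, hgL⟩ := (memLp_one_iff_integrable.2 hψi).exists_simpleFunc_eLpNorm_sub_lt
      ENNReal.one_ne_top (ε := ENNReal.ofReal δ) (by simpa using hδ)
    obtain ⟨C, hC⟩ := g.exists_forall_norm_le
    have hgi : Integrable g ν := memLp_one_iff_integrable.1 hgL
    have hρm : Measurable fun z => |ψ z - g z| := (hψ.sub g.measurable).abs
    have hρi : Integrable (fun z => |ψ z - g z|) ν := (hψi.sub hgi).abs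
    have hρ : ∫ z, |ψ z - g z| ∂ν < δ := by
      rw [eLpNorm_one_eq_lintegral_enorm] at hgδ
      have := ofReal_integral_norm_eq_lintegral_enorm (hψi.sub hgi)
      simp only [Pi.sub_apply, Real.norm_eq_abs] at this hgδ
      rw [← this] at hgδ
      exact (ENNReal.ofReal_lt_ofReal_iff hδ).1 hgδ
    have hgψ : |∫ z, g z ∂ν - ∫ z, ψ z ∂ν| < δ := by
      rw [← integral_sub hgi hψi]
      refine (abs_integral_le_integral_abs).trans_lt ?_
      simp_rw [abs_sub_comm (g _)]
      exact hρ
    have t1 := h.tendsto g g.measurable hgi (ε / 4) (by positivity)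
    have t2 := h.tendsto _ hρm hρi δ hδ
    have t3 : Tendsto (fun N : ℕ => ENNReal.ofReal (C ^ 2 / (N * (ε / 4) ^ 2))) atTop (𝓝 0) := by
      rw [← ENNReal.ofReal_zero]
      refine ENNReal.tendsto_ofReal ?_
      refine Tendsto.div_atTop tendsto_const_nhds ?_
      exact Tendsto.atTop_mul_const (by positivity) tendsto_natCast_atTop_atTop
    refine ⟨_, by simpa using t3.add (t1.add t2), ?_⟩
    filter_upwards [eventually_gt_atTop 0] with N hN
    have hm : MeasurableSet {y : Fin N → E | ε ≤ |(∑ i, ψ (y i)) / N - ∫ z, ψ z ∂ν|} :=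
      measurableSet_le measurable_const (by fun_prop)
    refine (Measure.bind_apply_le _ hm).trans ?_
    set S1 := {ω : Ω N | ε / 4 ≤ |(∑ i, ∫ z, g z ∂κ N i ω) / N - ∫ z, g z ∂ν|}
    set S2 := {ω : Ω N | δ ≤ |(∑ i, ∫ z, |ψ z - g z| ∂κ N i ω) / N - ∫ z, |ψ z - g z| ∂ν|}
    calc _ ≤ ∫⁻ ω, ENNReal.ofReal a + (ENNReal.ofReal (C ^ 2 / (N * (ε / 4) ^ 2)) +
          (S1.indicator (fun _ => 1) ω + S2.indicator (fun _ => 1) ω)) ∂P N := by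
          refine lintegral_mono_ae ?_
          filter_upwards [h.isProb N, h.integrable ψ hψ hψi N] with ω hp hi
          by_cases h1 : ω ∈ S1
          · simp only [h1, Set.indicator_of_mem]
            refine le_trans (prob_le_one (μ := Measure.pi fun i => κ N i ω)) ?_
            exact le_add_self.trans' (le_add_self.trans' le_self_add)
          by_cases h2 : ω ∈ S2
          · simp only [h2, Set.indicator_of_mem]
            refine le_trans (prob_le_one (μ := Measure.pi fun i => κ N i ω)) ?_
            exact le_add_self.trans' (le_add_self.trans' le_add_self)
          simp only [h1, h2, not_false_eq_true, Set.indicator_of_notMem, add_zero]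
          simp only [S1, S2, Set.mem_ofPred_eq, not_le] at h1 h2
          rw [add_comm]
          refine le_trans (measure_mono ?_) ((pi_deviation_le hN (fun i => κ N i ω) g.measurable hi
            (ε := ε / 4) (by positivity) hC).trans (add_le_add_right (ENNReal.ofReal_le_ofReal ?_) _))
          · intro y hy
            simp only [Set.mem_ofPred_eq] at hy ⊢
            have := abs_sub_le ((∑ i, ψ (y i)) / N) ((∑ i, ∫ z, g z ∂κ N i ω) / N) (∫ z, ψ z ∂ν)
            have := abs_sub_le ((∑ i, ∫ z, g z ∂κ N i ω) / N) (∫ z, g z ∂ν) (∫ z, ψ z ∂ν)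
            have : δ ≤ ε / 4 := min_le_left _ _
            linarith
          · rw [div_le_iff₀ (by positivity)]
            have := (abs_lt.1 h2).2
            have : δ ≤ a * ε / 8 := min_le_right _ _
            linarith
      _ ≤ _ := by
          rw [lintegral_add_left measurable_const, lintegral_add_left measurable_const]
          simp only [lintegral_const, measure_univ, mul_one]
          gcongr
          have i1 : MeasurableSet S1 := measurableSet_le measurable_const
            (((Finset.measurable_sum _ fun i _ => measurable_integral_measure (h.measurable N i)
              g.measurable).div_const _).sub_const _).abs
          rw [lintegral_add_left (measurable_const.indicator i1)]
          gcongr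
          · exact (lintegral_indicator_const_le _ _).trans_eq (one_mul _)
          · exact (lintegral_indicator_const_le _ _).trans_eq (one_mul _)

end Propagation

/-! ### Quantitative Gaussian approximation of characteristic functions -/

section Lyapunov

/-- For `|x| ≤ 1` the cubic remainder is at most `e |x| ^ 3`, and `p ≤ 3` allows `|x| ^ p`; for `|x|
≥ 1` every term is dominated by a multiple of `|x| ^ 2`, and `2 ≤ p`. The constant 4 covers both
regimes. -/
theorem norm_exp_mul_I_taylor_le {p : ℝ} (hp : 2 ≤ p) (hp3 : p ≤ 3) (x : ℝ) :
    ‖Complex.exp (x * Complex.I) - (1 + x * Complex.I - (x ^ 2 / 2 : ℝ))‖ ≤ 4 * |x| ^ p := by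
  rcases le_total |x| 1 with h | h
  · have h1 := Complex.norm_exp_sub_sum_le_norm_mul_exp (x * Complex.I) 3
    have h2 : ∑ m ∈ Finset.range 3, (x * Complex.I) ^ m / m.factorial
        = 1 + x * Complex.I - (x ^ 2 / 2 : ℝ) := by
      simp only [Finset.sum_range_succ, Finset.sum_range_zero, Nat.factorial]
      push_cast
      linear_combination ((x : ℂ) ^ 2 / 2) * Complex.I_sq
    rw [h2, norm_mul, Complex.norm_I, mul_one, Complex.norm_real, Real.norm_eq_abs] at h1
    refine h1.trans ?_
    have h3 : |x| ^ 3 ≤ |x| ^ p := by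
      rcases eq_or_lt_of_le (abs_nonneg x) with h0 | h0
      · rw [← h0, Real.zero_rpow (by linarith)]; norm_num
      · rw [← Real.rpow_natCast]
        exact Real.rpow_le_rpow_of_exponent_ge h0 h (by exact_mod_cast hp3)
    have h4 : Real.exp |x| ≤ 4 := by
      have := Real.exp_le_exp.2 h
      have := Real.exp_one_lt_d9
      linarith
    calc |x| ^ 3 * Real.exp |x| ≤ |x| ^ p * 4 := by gcongr
      _ = _ := mul_comm _ _
  · have h3 : |x| ^ 2 ≤ |x| ^ p := by
      rw [← Real.rpow_natCast]
      exact Real.rpow_le_rpow_of_exponent_le h (by exact_mod_cast hp)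
    calc _ ≤ 1 + (1 + |x| + x ^ 2 / 2) := by
          refine (norm_sub_le _ _).trans ?_
          rw [Complex.norm_exp_ofReal_mul_I]
          gcongr
          refine (norm_sub_le _ _).trans (add_le_add ((norm_add_le _ _).trans ?_) ?_)
          · simp
          · rw [Complex.norm_real, Real.norm_of_nonneg (by positivity)]
      _ ≤ 4 * |x| ^ 2 := by rw [sq_abs, ← sq_abs x]; nlinarith
      _ ≤ _ := by gcongr

theorem abs_exp_neg_taylor_le {q : ℝ} (hq : 1 ≤ q) (hq2 : q ≤ 2) {y : ℝ} (hy : 0 ≤ y) :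
    |Real.exp (-y) - (1 - y)| ≤ y ^ q := by
  rcases le_total y 1 with h | h
  · have h1 := Real.norm_exp_sub_one_sub_id_le (x := -y) (by rwa [norm_neg, Real.norm_of_nonneg hy])
    rw [norm_neg, Real.norm_of_nonneg hy, Real.norm_eq_abs] at h1
    rw [show Real.exp (-y) - (1 - y) = Real.exp (-y) - 1 - -y by ring]
    refine h1.trans ?_
    rcases eq_or_lt_of_le hy with h0 | h0
    · rw [← h0, Real.zero_rpow (by linarith)]; norm_num
    · rw [← Real.rpow_natCast]
      exact Real.rpow_le_rpow_of_exponent_ge h0 h (by exact_mod_cast hq2)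
  · have h1 : y ≤ y ^ q := by
      conv_lhs => rw [← Real.rpow_one y]
      exact Real.rpow_le_rpow_of_exponent_le h hq
    have h2 : Real.exp (-y) ≤ 1 := Real.exp_le_one_iff.2 (by linarith)
    have h3 := Real.add_one_le_exp (-y)
    rw [abs_of_nonneg (by linarith)]
    linarith

variable {E : Type*} [MeasurableSpace E] {ν : Measure E}

theorem integrable_abs_rpow {p : ℝ} (hp : 0 < p) {X : E → ℝ} (hX : MemLp X (ENNReal.ofReal p) ν) :
    Integrable (fun z => |X z| ^ p) ν := by
  have := hX.integrable_norm_rpow (by simpa using hp) ENNReal.ofReal_ne_top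
  simpa [ENNReal.toReal_ofReal hp.le] using this

theorem rpow_integral_le [IsProbabilityMeasure ν] {q : ℝ} (hq : 1 ≤ q) {Y : E → ℝ}
    (hY0 : ∀ z, 0 ≤ Y z) (hY : Integrable Y ν) (hYq : Integrable (fun z => Y z ^ q) ν) :
    (∫ z, Y z ∂ν) ^ q ≤ ∫ z, Y z ^ q ∂ν :=
  (convexOn_rpow hq).map_integral_le
    (continuousOn_id.rpow_const fun _ _ => Or.inr (by linarith)) isClosed_Ici
    (ae_of_all _ hY0) hY hYq

/-- Both terms are compared with `1 - s ^ 2 * v / 2`. The Taylor bound costs 4, and the real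
exponential costs 1, because Jensen bounds `v ^ (p / 2)` by the p-th absolute moment. -/
theorem norm_integral_exp_sub_le [IsProbabilityMeasure ν] {p : ℝ} (hp : 2 ≤ p) (hp3 : p ≤ 3)
    {X : E → ℝ} (hX : MemLp X (ENNReal.ofReal p) ν) (hX0 : ∫ z, X z ∂ν = 0) (s : ℝ) :
    ‖∫ z, Complex.exp ((s * X z : ℝ) * Complex.I) ∂ν
      - Complex.exp ((-(s ^ 2 * (∫ z, X z ^ 2 ∂ν) / 2) : ℝ) : ℂ)‖ ≤
      5 * |s| ^ p * ∫ z, |X z| ^ p ∂ν := by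
  have hp1 : (1 : ℝ≥0∞) ≤ ENNReal.ofReal p := by
    rw [← ENNReal.ofReal_one]; exact ENNReal.ofReal_le_ofReal (by linarith)
  have hp2 : (2 : ℝ≥0∞) ≤ ENNReal.ofReal p := by
    rw [← ENNReal.ofReal_ofNat]; exact ENNReal.ofReal_le_ofReal hp
  have i1 : Integrable X ν := hX.integrable hp1
  have i2 : Integrable (fun z => X z ^ 2) ν := (hX.mono_exponent hp2).integrable_sq
  have ip : Integrable (fun z => |X z| ^ p) ν := integrable_abs_rpow (by linarith) hX
  have ie : Integrable (fun z => Complex.exp ((s * X z : ℝ) * Complex.I)) ν := by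
    have := hX.aestronglyMeasurable
    refine Integrable.of_bound (C := 1) ?_ (ae_of_all _ fun z => ?_)
    · have : AEMeasurable X ν := this.aemeasurable
      exact AEMeasurable.aestronglyMeasurable (by fun_prop)
    · rw [Complex.norm_exp_ofReal_mul_I]
  set v := ∫ z, X z ^ 2 ∂ν with hv
  have hv0 : 0 ≤ v := integral_nonneg fun z => sq_nonneg _
  have j1 : Integrable (fun z => ((s * X z : ℝ) : ℂ) * Complex.I) ν :=
    ((i1.const_mul s).ofReal).mul_const _
  have j2 : Integrable (fun z => (((s * X z) ^ 2 / 2 : ℝ) : ℂ)) ν := by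
    simp_rw [mul_pow]
    exact ((i2.const_mul (s ^ 2)).div_const 2).ofReal
  have j3 : Integrable (fun z => (1 + (s * X z : ℝ) * Complex.I : ℂ)) ν :=
    (integrable_const _).add j1
  have j4 : Integrable (fun z => (1 + (s * X z : ℝ) * Complex.I - ((s * X z) ^ 2 / 2 : ℝ) : ℂ)) ν :=
    j3.sub j2
  have htay : ∫ z, (1 + (s * X z : ℝ) * Complex.I - ((s * X z) ^ 2 / 2 : ℝ) : ℂ) ∂ν
      = ((1 - s ^ 2 * v / 2 : ℝ) : ℂ) := by
    rw [integral_sub j3 j2, integral_add (integrable_const _) j1,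
      integral_mul_const, integral_complex_ofReal, integral_complex_ofReal, integral_const_mul, hX0]
    simp_rw [mul_pow]
    rw [integral_div, integral_const_mul]
    simp [← hv]
  have hA : ‖∫ z, Complex.exp ((s * X z : ℝ) * Complex.I) ∂ν - ((1 - s ^ 2 * v / 2 : ℝ) : ℂ)‖
      ≤ 4 * |s| ^ p * ∫ z, |X z| ^ p ∂ν := by
    rw [← htay, ← integral_sub ie j4, ← integral_const_mul]
    refine norm_integral_le_of_norm_le (ip.const_mul _) (ae_of_all _ fun z => ?_)
    refine (norm_exp_mul_I_taylor_le hp hp3 (s * X z)).trans_eq ?_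
    rw [abs_mul, Real.mul_rpow (abs_nonneg _) (abs_nonneg _)]; ring
  have hB : ‖((1 - s ^ 2 * v / 2 : ℝ) : ℂ) - Complex.exp ((-(s ^ 2 * v / 2) : ℝ) : ℂ)‖
      ≤ |s| ^ p * ∫ z, |X z| ^ p ∂ν := by
    rw [← Complex.ofReal_exp, ← Complex.ofReal_sub, Complex.norm_real, norm_sub_rev,
      Real.norm_eq_abs]
    refine (abs_exp_neg_taylor_le (q := p / 2) (by linarith) (by linarith) (by positivity)).trans ?_
    have hsq : ∀ a : ℝ, (a ^ 2) ^ (p / 2) = |a| ^ p := fun a => by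
      rw [← sq_abs, ← Real.rpow_natCast, ← Real.rpow_mul (abs_nonneg _)]
      congr 1; push_cast; ring
    calc (s ^ 2 * v / 2) ^ (p / 2) ≤ (s ^ 2 * v) ^ (p / 2) := by
          refine Real.rpow_le_rpow (by positivity) ?_ (by linarith)
          have : 0 ≤ s ^ 2 * v := by positivity
          linarith
      _ = |s| ^ p * v ^ (p / 2) := by rw [Real.mul_rpow (sq_nonneg _) hv0, hsq]
      _ ≤ _ := by
          gcongr
          have := rpow_integral_le (q := p / 2) (by linarith) (fun z => sq_nonneg (X z)) i2
            (by simpa only [hsq] using ip)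
          simpa only [hsq] using this
  have := norm_sub_le_norm_sub_add_norm_sub
    (∫ z, Complex.exp ((s * X z : ℝ) * Complex.I) ∂ν) ((1 - s ^ 2 * v / 2 : ℝ) : ℂ)
    (Complex.exp ((-(s ^ 2 * v / 2) : ℝ) : ℂ))
  linarith

/-- The factor `2 ^ p` comes from bounding a sum by twice the maximum, the remaining 2 from Jensen
applied to the mean. -/
theorem integral_abs_sub_mean_rpow_le [IsProbabilityMeasure ν] {p : ℝ} (hp : 1 ≤ p)
    {ψ : E → ℝ} (hψ : MemLp ψ (ENNReal.ofReal p) ν) :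
    ∫ z, |ψ z - ∫ z', ψ z' ∂ν| ^ p ∂ν ≤ 2 ^ (p + 1) * ∫ z, |ψ z| ^ p ∂ν := by
  set m := ∫ z', ψ z' ∂ν with hm
  have hp0 : 0 < p := by linarith
  have hp1 : (1 : ℝ≥0∞) ≤ ENNReal.ofReal p := by
    rw [← ENNReal.ofReal_one]; exact ENNReal.ofReal_le_ofReal hp
  have ip := integrable_abs_rpow hp0 hψ
  have hmp : |m| ^ p ≤ ∫ z, |ψ z| ^ p ∂ν :=
    (Real.rpow_le_rpow (abs_nonneg _) abs_integral_le_integral_abs hp0.le).trans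
      (rpow_integral_le hp (fun z => abs_nonneg _) (hψ.integrable hp1).abs ip)
  have hpt : ∀ z, |ψ z - m| ^ p ≤ 2 ^ p * (|ψ z| ^ p + |m| ^ p) := fun z => by
    calc |ψ z - m| ^ p ≤ (2 * max |ψ z| |m|) ^ p := by
          refine Real.rpow_le_rpow (abs_nonneg _) ?_ hp0.le
          have := abs_sub (ψ z) m
          have := le_max_left |ψ z| |m|
          have := le_max_right |ψ z| |m|
          linarith
      _ = 2 ^ p * (max |ψ z| |m|) ^ p := by rw [Real.mul_rpow (by norm_num) (by positivity)]
      _ ≤ _ := by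
          gcongr
          rcases max_cases |ψ z| |m| with ⟨h, _⟩ | ⟨h, _⟩ <;> rw [h]
          · exact le_add_of_nonneg_right (by positivity)
          · exact le_add_of_nonneg_left (by positivity)
  calc _ ≤ ∫ z, 2 ^ p * (|ψ z| ^ p + |m| ^ p) ∂ν := by
        refine integral_mono (integrable_abs_rpow hp0 (hψ.sub (memLp_const m)))
          ((ip.add (integrable_const _)).const_mul _) hpt
    _ = 2 ^ p * (∫ z, |ψ z| ^ p ∂ν + |m| ^ p) := by
        rw [integral_const_mul, integral_add ip (integrable_const _)]; simp
    _ ≤ 2 ^ p * (∫ z, |ψ z| ^ p ∂ν + ∫ z, |ψ z| ^ p ∂ν) := by gcongr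
    _ = _ := by rw [Real.rpow_add (by norm_num), Real.rpow_one]; ring

/-- Factors are exchanged one at a time, and those left untouched have modulus at most 1. -/
theorem norm_prod_sub_prod_le {ι : Type*} (s : Finset ι) (a b : ι → ℂ)
    (ha : ∀ i ∈ s, ‖a i‖ ≤ 1) (hb : ∀ i ∈ s, ‖b i‖ ≤ 1) :
    ‖∏ i ∈ s, a i - ∏ i ∈ s, b i‖ ≤ ∑ i ∈ s, ‖a i - b i‖ := by
  classical
  induction s using Finset.induction_on with
  | empty => simp
  | insert i s hi ih =>
    rw [Finset.prod_insert hi, Finset.prod_insert hi, Finset.sum_insert hi]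
    have h1 := ih (fun j hj => ha j (Finset.mem_insert_of_mem hj))
      (fun j hj => hb j (Finset.mem_insert_of_mem hj))
    have h2 : ‖∏ j ∈ s, a j‖ ≤ 1 := by
      rw [norm_prod]
      exact Finset.prod_le_one (fun _ _ => norm_nonneg _)
        fun j hj => ha j (Finset.mem_insert_of_mem hj)
    calc ‖a i * ∏ j ∈ s, a j - b i * ∏ j ∈ s, b j‖
        = ‖(a i - b i) * ∏ j ∈ s, a j + b i * (∏ j ∈ s, a j - ∏ j ∈ s, b j)‖ := by congr 1; ring
      _ ≤ ‖a i - b i‖ * ‖∏ j ∈ s, a j‖ + ‖b i‖ * ‖∏ j ∈ s, a j - ∏ j ∈ s, b j‖ := by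
          refine (norm_add_le _ _).trans ?_
          rw [norm_mul, norm_mul]
      _ ≤ ‖a i - b i‖ * 1 + 1 * ∑ j ∈ s, ‖a j - b j‖ := by
          gcongr
          exact hb i (Finset.mem_insert_self _ _)
      _ = _ := by ring

/-- Once the means are split off as a phase, independence turns both sides into products of factors
in the unit disc. The bound is not asymptotic, since it is applied to the random measures at each
fixed outcome. -/
theorem norm_integral_pi_exp_sub_le {N : ℕ} (ν : Fin N → Measure E)
    [∀ i, IsProbabilityMeasure (ν i)] {p : ℝ} (hp : 2 ≤ p) (hp3 : p ≤ 3) {ψ : E → ℝ}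
    (hψ : ∀ i, MemLp ψ (ENNReal.ofReal p) (ν i)) (s : ℝ) :
    ‖∫ y, Complex.exp ((s * ∑ i, ψ (y i) : ℝ) * Complex.I) ∂Measure.pi ν
      - Complex.exp ((s * ∑ i, ∫ z, ψ z ∂ν i : ℝ) * Complex.I)
        * Complex.exp ((-(s ^ 2 * (∑ i, Var[ψ; ν i]) / 2) : ℝ) : ℂ)‖ ≤
      5 * 2 ^ (p + 1) * |s| ^ p * ∑ i, ∫ z, |ψ z| ^ p ∂ν i := by
  set m : Fin N → ℝ := fun i => ∫ z, ψ z ∂ν i with hm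
  have hp1 : (1 : ℝ≥0∞) ≤ ENNReal.ofReal p := by
    rw [← ENNReal.ofReal_one]; exact ENNReal.ofReal_le_ofReal (by linarith)
  have e1 : ∫ y, Complex.exp ((s * ∑ i, ψ (y i) : ℝ) * Complex.I) ∂Measure.pi ν
      = Complex.exp ((s * ∑ i, m i : ℝ) * Complex.I) *
        ∏ i, ∫ z, Complex.exp ((s * (ψ z - m i) : ℝ) * Complex.I) ∂ν i := by
    rw [← integral_fintype_prod_eq_prod
      (f := fun i z => Complex.exp ((s * (ψ z - m i) : ℝ) * Complex.I)), ← integral_const_mul]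
    congr 1 with y
    rw [← Complex.exp_sum, ← Complex.exp_add, ← Finset.sum_mul, ← add_mul]
    congr 2
    push_cast
    rw [← Finset.mul_sum, Finset.sum_sub_distrib]
    ring
  have e2 : Complex.exp ((-(s ^ 2 * (∑ i, Var[ψ; ν i]) / 2) : ℝ) : ℂ)
      = ∏ i, Complex.exp ((-(s ^ 2 * (∫ z, (ψ z - m i) ^ 2 ∂ν i) / 2) : ℝ) : ℂ) := by
    rw [← Complex.exp_sum]
    congr 1
    rw [← Complex.ofReal_sum, Finset.sum_neg_distrib, ← Finset.sum_div, ← Finset.mul_sum]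
    congr 5 with i
    exact variance_eq_integral (hψ i).aestronglyMeasurable.aemeasurable
  rw [e1, e2, ← mul_sub, norm_mul, Complex.norm_exp_ofReal_mul_I, one_mul, Finset.mul_sum]
  refine (norm_prod_sub_prod_le _ _ _ (fun i _ => ?_) (fun i _ => ?_)).trans
    (Finset.sum_le_sum fun i _ => ?_)
  · refine (norm_integral_le_of_norm_le_const (C := 1) (ae_of_all _ fun z => ?_)).trans_eq (by simp)
    rw [Complex.norm_exp_ofReal_mul_I]
  · rw [← Complex.ofReal_exp, Complex.norm_real, Real.norm_of_nonneg (Real.exp_pos _).le,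
      Real.exp_le_one_iff, neg_nonpos]
    have : 0 ≤ ∫ z, (ψ z - m i) ^ 2 ∂ν i := integral_nonneg fun z => sq_nonneg _
    positivity
  · have hX : MemLp (fun z => ψ z - m i) (ENNReal.ofReal p) (ν i) := (hψ i).sub (memLp_const _)
    have hX0 : ∫ z, (ψ z - m i) ∂ν i = 0 := by
      rw [integral_sub ((hψ i).integrable hp1) (integrable_const _)]; simp [hm]
    refine (norm_integral_exp_sub_le hp hp3 hX hX0 s).trans ?_
    have := integral_abs_sub_mean_rpow_le (by linarith) (hψ i)
    calc _ ≤ 5 * |s| ^ p * (2 ^ (p + 1) * ∫ z, |ψ z| ^ p ∂ν i) := by gcongr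
      _ = _ := by ring

end Lyapunov

/-! ### The conditional central limit theorem -/

section CLT

variable {Ω : ℕ → Type*} [∀ N, MeasurableSpace (Ω N)] {P : ∀ N, Measure (Ω N)}
variable {E : Type*} [MeasurableSpace E] {κ : ∀ N, Fin N → Ω N → Measure E} {ν : Measure E}

theorem memLp_ofReal_iff {p : ℝ} (hp : 0 < p) {μ : Measure E} {ψ : E → ℝ} (hψ : Measurable ψ) :
    MemLp ψ (ENNReal.ofReal p) μ ↔ Integrable (fun z => |ψ z| ^ p) μ := by
  refine ⟨integrable_abs_rpow hp, fun hi => ?_⟩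
  rw [← integrable_norm_rpow_iff hψ.aestronglyMeasurable (by simpa using hp)
    ENNReal.ofReal_ne_top, ENNReal.toReal_ofReal hp.le]
  exact hi

theorem IsPropagation.memLp (h : IsPropagation P κ ν) {p : ℝ} (hp : 0 < p)
    {ψ : E → ℝ} (hψ : Measurable ψ) (hψL : MemLp ψ (ENNReal.ofReal p) ν) (N : ℕ) :
    ∀ᵐ ω ∂P N, ∀ i, MemLp ψ (ENNReal.ofReal p) (κ N i ω) := by
  filter_upwards [h.integrable _ (hψ.abs.pow_const p) (integrable_abs_rpow hp hψL) N] with ω hω i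
  exact (memLp_ofReal_iff hp hψ).2 (hω i)

/-- The conditional characteristic function `G` is close to `c * H`, where `c` is the deterministic
Gaussian factor of variance `v` and `H` the phase of the conditional mean. The expectation of `H`
converges by `hM`. -/
theorem IsPropagation.asymptoticNormal (h : IsPropagation P κ ν) [∀ N, IsProbabilityMeasure (P N)]
    {p : ℝ} (hp : 2 < p) (hp3 : p ≤ 3) {ψ : E → ℝ} (hψ : Measurable ψ)
    (hψL : MemLp ψ (ENNReal.ofReal p) ν) {V v : ℝ}
    (hM : AsymptoticNormal P (fun N ω => (∑ i, ∫ z, ψ z ∂κ N i ω) / √N) V)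
    (hv : TendstoInProb P (fun N ω => (∑ i, Var[ψ; κ N i ω]) / N) v) :
    AsymptoticNormal (propagated P κ) (fun N y => (∑ i, ψ (y i)) / √N) (V + v) := by
  have hp0 : 0 < p := by linarith
  intro u
  set G : ∀ N, Ω N → ℂ := fun N ω =>
    ∫ y, Complex.exp ((u * ((∑ i, ψ (y i)) / √N) : ℝ) * Complex.I) ∂Measure.pi fun i => κ N i ω
  set H : ∀ N, Ω N → ℂ := fun N ω =>
    Complex.exp ((u * ((∑ i, ∫ z, ψ z ∂κ N i ω) / √N) : ℝ) * Complex.I)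
  set c : ℂ := Complex.exp ((-(u ^ 2 * v / 2) : ℝ) : ℂ)
  set C : ℝ := 5 * 2 ^ (p + 1) * |u| ^ p
  have hprob := fun N => h.isProbabilityMeasure (P := P) N
  have hSm : ∀ N, Measurable fun y : Fin N → E =>
      Complex.exp ((u * ((∑ i, ψ (y i)) / √N) : ℝ) * Complex.I) := fun N => by fun_prop
  have hexp : ∀ N, ∫ y, Complex.exp ((u * ((∑ i, ψ (y i)) / √N) : ℝ) * Complex.I)
      ∂propagated P κ N = ∫ ω, G N ω ∂P N := fun N => by
    refine integral_bind (h.measurable_pi N) ?_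
    refine Integrable.of_bound (μ := propagated P κ N) (C := 1) (hSm N).aestronglyMeasurable
      (ae_of_all _ fun y => ?_)
    rw [Complex.norm_exp_ofReal_mul_I]
  have hGm : ∀ N, StronglyMeasurable (G N) := fun N =>
    (hSm N).stronglyMeasurable.integral_kernel (κ := ⟨_, h.measurable_pi N⟩)
  have hG1 : ∀ N, ∀ᵐ ω ∂P N, ‖G N ω‖ ≤ 1 := fun N => by
    filter_upwards [h.isProb N] with ω hω
    refine (norm_integral_le_of_norm_le_const (C := 1) (ae_of_all _ fun z => ?_)).trans_eq (by simp)
    rw [Complex.norm_exp_ofReal_mul_I]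
  have hHm : ∀ N, Measurable (H N) := fun N => by
    have : ∀ i, Measurable fun ω => ∫ z, ψ z ∂κ N i ω := fun i =>
      measurable_integral_measure (h.measurable N i) hψ
    fun_prop
  have hH1 : ∀ N ω, ‖H N ω‖ = 1 := fun N ω => Complex.norm_exp_ofReal_mul_I _
  -- The first summand is the Lyapunov error at `s = u / √N`: a sum of `N` p-th moments times `|s| ^
  -- p` scales like `N ^ (1 - p / 2)`, which vanishes since `p > 2`. The second is the cost of
  -- replacing the random averaged variance by `v`.
  set R : ∀ N, Ω N → ℝ := fun N ω =>
    ((∑ i, ∫ z, |ψ z| ^ p ∂κ N i ω) / N) * (C * (N : ℝ) ^ (1 - p / 2)) +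
    |Real.exp (-(u ^ 2 * ((∑ i, Var[ψ; κ N i ω]) / N) / 2)) - Real.exp (-(u ^ 2 * v / 2))|
  have hR : TendstoInProb P R 0 := by
    have t1 := h.tendsto _ (hψ.abs.pow_const p) (integrable_abs_rpow hp0 hψL)
    have t0 : Tendsto (fun N : ℕ => C * (N : ℝ) ^ (1 - p / 2)) atTop (𝓝 0) := by
      have := (tendsto_rpow_neg_atTop (y := p / 2 - 1) (by linarith)).comp
        (tendsto_natCast_atTop_atTop (R := ℝ))
      simpa [Function.comp_def] using this.const_mul C
    have t2 := TendstoInProb.of_tendsto (P := P) t0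
    have t3 := t1.map₂ t2 (F := fun x y => x * y) (by fun_prop)
    have t4 := hv.map₂ hv (F := fun x _ => |Real.exp (-(u ^ 2 * x / 2)) - Real.exp (-(u ^ 2 * v / 2))|)
      (by fun_prop)
    have t5 := t3.map₂ t4 (F := fun x y => x + y) (by fun_prop)
    simpa using t5
  have key := hR.tendsto_integral (Z := fun N ω => G N ω - c * H N ω)
    (B := 1 + ‖c‖) (fun N => by
      filter_upwards [hG1 N] with ω hω
      refine (norm_sub_le _ _).trans ?_
      rw [norm_mul, hH1, mul_one]
      gcongr) (by
    filter_upwards [eventually_gt_atTop 0] with N hN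
    have hN' : (0 : ℝ) < N := by exact_mod_cast hN
    filter_upwards [h.isProb N, h.memLp hp0 hψ hψL N] with ω hω hL
    have hb := norm_integral_pi_exp_sub_le (fun i => κ N i ω) hp.le hp3 hL (u / √N)
    have a1 : ∀ x : ℝ, u / √N * x = u * (x / √N) := fun x => by ring
    have a2 : (u / √N) ^ 2 = u ^ 2 / N := by rw [div_pow, Real.sq_sqrt hN'.le]
    have a3 : |u / √N| ^ p = |u| ^ p * (N : ℝ) ^ (1 - p / 2) / N := by
      rw [abs_div, abs_of_nonneg (Real.sqrt_nonneg _), Real.div_rpow (abs_nonneg _)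
        (Real.sqrt_nonneg _), Real.sqrt_eq_rpow, ← Real.rpow_mul hN'.le,
        Real.rpow_sub hN', Real.rpow_one]
      field_simp
    simp_rw [a1] at hb
    rw [a2, a3] at hb
    set vN := ∑ i, Var[ψ; κ N i ω]
    have a4 : u ^ 2 / N * vN / 2 = u ^ 2 * (vN / N) / 2 := by ring
    rw [a4] at hb
    have hd : ‖H N ω * Complex.exp ((-(u ^ 2 * (vN / N) / 2) : ℝ) : ℂ) - c * H N ω‖
        = |Real.exp (-(u ^ 2 * (vN / N) / 2)) - Real.exp (-(u ^ 2 * v / 2))| := by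
      change ‖_ - Complex.exp ((-(u ^ 2 * v / 2) : ℝ) : ℂ) * _‖ = _
      rw [mul_comm (Complex.exp ((-(u ^ 2 * v / 2) : ℝ) : ℂ)), ← mul_sub, norm_mul, hH1, one_mul, ← Complex.ofReal_exp, ← Complex.ofReal_exp,
        ← Complex.ofReal_sub, Complex.norm_real, Real.norm_eq_abs]
    refine (norm_sub_le_norm_sub_add_norm_sub _
      (H N ω * Complex.exp ((-(u ^ 2 * (vN / N) / 2) : ℝ) : ℂ)) _).trans ?_
    rw [hd]
    refine add_le_add (hb.trans_eq ?_) le_rfl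
    simp only [C]; ring)
  have hlim := key.add ((hM u).const_mul c)
  have hval : (0 : ℂ) + c * Complex.exp ((-(u ^ 2 * V / 2) : ℝ) : ℂ)
      = Complex.exp ((-(u ^ 2 * (V + v) / 2) : ℝ) : ℂ) := by
    rw [zero_add, ← Complex.exp_add]; congr 1; push_cast; ring
  rw [hval] at hlim
  refine hlim.congr fun N => ?_
  have iG : Integrable (G N) (P N) := Integrable.of_bound (hGm N).aestronglyMeasurable 1 (hG1 N)
  have iH : Integrable (H N) (P N) := Integrable.of_bound (hHm N).aestronglyMeasurable 1
    (ae_of_all _ fun ω => (hH1 N ω).le)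
  rw [hexp, integral_sub iG (iH.const_mul c), integral_const_mul]
  ring

end CLT

/-! ### Independent draws from a fixed law -/

section Constant

variable {E : Type*} [MeasurableSpace E] {ν : Measure E}

/-- With a one-point past, the initial draws become an instance of conditionally independent
sampling and need no separate limit theorem. -/
theorem isPropagation_const (ν : Measure E) [IsProbabilityMeasure ν] :
    IsPropagation (Ω := fun _ => Unit) (fun _ => Measure.dirac ()) (fun _ _ _ => ν) ν where
  measurable _ _ := measurable_const
  isFinite _ _ _ := inferInstance
  isProb _ := ae_of_all _ fun _ _ => inferInstance
  ac _ _ hs0 _ := ae_of_all _ fun _ _ => hs0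
  integrable _ _ hψi _ := ae_of_all _ fun _ _ => hψi
  tendsto ψ _ _ := by
    refine (TendstoInProb.of_tendsto (a := fun _ => ∫ z, ψ z ∂ν) tendsto_const_nhds).congr ?_
    filter_upwards [eventually_gt_atTop 0] with N hN
    have hN' : (0 : ℝ) < N := by exact_mod_cast hN
    refine ae_of_all _ fun _ => ?_
    rw [Finset.sum_const, Finset.card_univ, Fintype.card_fin, nsmul_eq_mul]
    field_simp

theorem propagated_const (ν : Measure E) (N : ℕ) :
    propagated (Ω := fun _ => Unit) (fun _ => Measure.dirac ()) (fun _ _ _ => ν) N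
      = Measure.pi fun _ => ν := by
  rw [propagated, Measure.dirac_bind measurable_const]

end Constant

/-! ### Conditional variance under a common random measure -/

section Variance

variable {Ω : ℕ → Type*} [∀ N, MeasurableSpace (Ω N)] {P : ∀ N, Measure (Ω N)}
variable {E : Type*} [MeasurableSpace E] {ν : Measure E}

/-- As in resampling, all points share one measure, so the averaged variance is the second moment
minus the squared mean, and both converge. -/
theorem IsPropagation.tendsto_variance [∀ N, IsProbabilityMeasure (P N)] [IsProbabilityMeasure ν]
    {κ : ∀ N, Ω N → Measure E} (h : IsPropagation P (fun N _ => κ N) ν) {ψ : E → ℝ}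
    (hψ : Measurable ψ) (hψL : MemLp ψ 2 ν) :
    TendstoInProb P (fun N ω => (∑ _i : Fin N, Var[ψ; κ N ω]) / N) Var[ψ; ν] := by
  have h1 := h.tendsto ψ hψ (hψL.integrable one_le_two)
  have h2 := h.tendsto (fun z => ψ z ^ 2) (hψ.pow_const 2) hψL.integrable_sq
  have h3 := h2.map₂ h1 (F := fun x y => x - y ^ 2) (by fun_prop)
  rw [variance_eq_sub hψL]
  refine h3.congr ?_
  filter_upwards [eventually_gt_atTop 0] with N hN
  have hN' : (0 : ℝ) < N := by exact_mod_cast hN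
  filter_upwards [h.isProb N, h.integrable _ (hψ.pow_const 2) hψL.integrable_sq N] with ω hω hi
  have := hω ⟨0, hN⟩
  have hL : MemLp ψ 2 (κ N ω) := (memLp_two_iff_integrable_sq hψ.aestronglyMeasurable).2
    (hi ⟨0, hN⟩)
  rw [variance_eq_sub hL]
  simp only [Finset.sum_const, Finset.card_univ, Fintype.card_fin, nsmul_eq_mul, Pi.pow_apply]
  field_simp

end Variance

/-! ### Propagation through a Markov kernel -/

section Mutation

variable {F E : Type*} [MeasurableSpace F] [MeasurableSpace E] {ν : Measure F}
  {P : ∀ N, Measure (Fin N → F)} {K : Kernel F E}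

theorem integrable_integral_kernel {ψ : E → ℝ} (hψ : Measurable ψ)
    (hψi : Integrable ψ (ν.bind K)) : Integrable (fun θ => ∫ z, ψ z ∂K θ) ν := by
  refine Integrable.mono ((integrable_bind_iff K.measurable hψ).1 hψi).2
    (measurable_integral_measure K.measurable hψ).aestronglyMeasurable (ae_of_all _ fun θ => ?_)
  refine (norm_integral_le_integral_norm _).trans (le_abs_self _)

theorem IsConsistent.isPropagation_kernel (h : IsConsistent P ν) [IsFiniteKernel K]
    (hK : ∀ᵐ θ ∂ν, IsProbabilityMeasure (K θ)) :
    IsPropagation (Ω := fun N => Fin N → F) P (fun _ i θ => K (θ i)) (ν.bind K) where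
  measurable _ i := K.measurable.comp (measurable_pi_apply i)
  isFinite _ _ _ := inferInstance
  isProb N := h.ae (p := fun θ => IsProbabilityMeasure (K θ)) hK N
  ac s hs hs0 N := by
    refine h.ae (p := fun θ => K θ s = 0) ?_ N
    rw [Measure.bind_apply hs K.measurable.aemeasurable,
      lintegral_eq_zero_iff (K.measurable_coe hs)] at hs0
    exact hs0
  integrable ψ hψ hψi N := h.ae (p := fun θ => Integrable ψ (K θ)) ((integrable_bind_iff K.measurable hψ).1 hψi).1 N
  tendsto ψ hψ hψi := by
    rw [integral_bind K.measurable hψi]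
    exact h.tendsto (fun θ => ∫ z, ψ z ∂K θ) (measurable_integral_measure K.measurable hψ)
      (integrable_integral_kernel hψ hψi)

theorem variance_kernel_eq (hK : ∀ᵐ θ ∂ν, IsProbabilityMeasure (K θ)) {ψ : E → ℝ}
    (hψ : Measurable ψ) (hψL : MemLp ψ 2 (ν.bind K)) :
    ∀ᵐ θ ∂ν, IsProbabilityMeasure (K θ) ∧ MemLp ψ 2 (K θ) ∧
      Var[ψ; K θ] = ∫ z, ψ z ^ 2 ∂K θ - (∫ z, ψ z ∂K θ) ^ 2 := by
  filter_upwards [hK, ((integrable_bind_iff K.measurable (hψ.pow_const 2)).1 hψL.integrable_sq).1]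
    with θ hθ hi
  have hL : MemLp ψ 2 (K θ) := (memLp_two_iff_integrable_sq hψ.aestronglyMeasurable).2 hi
  exact ⟨hθ, hL, variance_eq_sub hL⟩

theorem integrable_variance_kernel (hK : ∀ᵐ θ ∂ν, IsProbabilityMeasure (K θ)) {ψ : E → ℝ}
    (hψ : Measurable ψ) (hψL : MemLp ψ 2 (ν.bind K)) :
    Integrable (fun θ => ∫ z, ψ z ^ 2 ∂K θ - (∫ z, ψ z ∂K θ) ^ 2) ν := by
  have i2 := integrable_integral_kernel (hψ.pow_const 2) hψL.integrable_sq
  refine i2.mono' ((measurable_integral_measure K.measurable (hψ.pow_const 2)).sub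
    ((measurable_integral_measure K.measurable hψ).pow_const 2)).aestronglyMeasurable ?_
  filter_upwards [variance_kernel_eq hK hψ hψL] with θ hθ
  rw [← hθ.2.2, Real.norm_of_nonneg (variance_nonneg _ _), hθ.2.2]
  linarith [sq_nonneg (∫ z, ψ z ∂K θ)]

theorem lintegral_evariance_kernel (hK : ∀ᵐ θ ∂ν, IsProbabilityMeasure (K θ)) {ψ : E → ℝ}
    (hψ : Measurable ψ) (hψL : MemLp ψ 2 (ν.bind K)) :
    ∫⁻ θ, evariance ψ (K θ) ∂ν
      = ENNReal.ofReal (∫ θ, (∫ z, ψ z ^ 2 ∂K θ - (∫ z, ψ z ∂K θ) ^ 2) ∂ν) := by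
  rw [ofReal_integral_eq_lintegral_ofReal (integrable_variance_kernel hK hψ hψL)]
  · refine lintegral_congr_ae ?_
    filter_upwards [variance_kernel_eq hK hψ hψL] with θ ⟨_, h2, h3⟩
    rw [← h3, ofReal_variance h2]
  · filter_upwards [variance_kernel_eq hK hψ hψL] with θ ⟨_, h2, h3⟩
    rw [← h3]
    exact variance_nonneg _ _

/-- The conditional variance of a square-integrable `ψ` is in general merely integrable, which is
why consistency is required for all integrable functions. Its moment formula is used because it is
measurable and agrees with the variance almost everywhere. -/
theorem IsConsistent.tendsto_variance_kernel (h : IsConsistent P ν)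
    (hK : ∀ᵐ θ ∂ν, IsProbabilityMeasure (K θ)) {ψ : E → ℝ}
    (hψ : Measurable ψ) (hψL : MemLp ψ 2 (ν.bind K)) :
    TendstoInProb (Ω := fun N => Fin N → F) P (fun N θ => (∑ i, Var[ψ; K (θ i)]) / N)
      (∫⁻ θ, evariance ψ (K θ) ∂ν).toReal := by
  have h0 : 0 ≤ ∫ θ, (∫ z, ψ z ^ 2 ∂K θ - (∫ z, ψ z ∂K θ) ^ 2) ∂ν := by
    refine integral_nonneg_of_ae ?_
    filter_upwards [variance_kernel_eq hK hψ hψL] with θ hθ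
    rw [← hθ.2.2]
    exact variance_nonneg _ _
  rw [lintegral_evariance_kernel hK hψ hψL, ENNReal.toReal_ofReal h0]
  refine (h.tendsto _ ((measurable_integral_measure K.measurable (hψ.pow_const 2)).sub
    ((measurable_integral_measure K.measurable hψ).pow_const 2))
    (integrable_variance_kernel hK hψ hψL)).congr (Eventually.of_forall fun N => ?_)
  filter_upwards [h.ae (variance_kernel_eq hK hψ hψL) N] with θ hθ
  exact congrArg (· / (N : ℝ)) (Finset.sum_congr rfl fun i _ => (hθ i).2.2)

end Mutation

/-! ### Importance weights and multinomial resampling -/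

section Reweighting

variable {E G : Type*} [MeasurableSpace E] [MeasurableSpace G] {ν π : Measure E} {w : E → ℝ}

/-- `w` is a version of the density of `π` with respect to an equivalent measure `ν`. -/
structure IsReweighting (ν π : Measure E) (w : E → ℝ) : Prop where
  measurable : Measurable w
  nonneg : ∀ z, 0 ≤ w z
  pos : ∀ᵐ z ∂ν, 0 < w z
  ac : ν ≪ π
  integrable : ∀ ψ : E → ℝ, Measurable ψ → (Integrable (fun z => w z * ψ z) ν ↔ Integrable ψ π)
  integral : ∀ ψ : E → ℝ, ∫ z, w z * ψ z ∂ν = ∫ z, ψ z ∂π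

/-- Unit weights make the equal-weight resample of the initial draws a special case of resampling.
-/
theorem isReweighting_one (ν : Measure E) : IsReweighting ν ν fun _ => 1 where
  measurable := measurable_const
  nonneg _ := zero_le_one
  pos := ae_of_all _ fun _ => one_pos
  ac := Measure.AbsolutelyContinuous.rfl
  integrable ψ _ := by simp
  integral ψ := by simp

/-- The weighted empirical measure of the images of the particles under `q`. -/
noncomputable def weightedEmpirical (w : E → ℝ) (q : E → G) (N : ℕ) (y : Fin N → E) : Measure G :=
  ∑ j, ENNReal.ofReal (w (y j) / ∑ i, w (y i)) • Measure.dirac (q (y j))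

theorem measurable_sum_smul_dirac {A : Type*} [MeasurableSpace A] {N : ℕ} {c : Fin N → A → ℝ}
    {q : Fin N → A → G} (hc : ∀ j, Measurable (c j)) (hq : ∀ j, Measurable (q j)) :
    Measurable fun a => ∑ j, ENNReal.ofReal (c j a) • Measure.dirac (q j a) := by
  refine Measure.measurable_of_measurable_coe _ fun s hs => ?_
  simp only [Measure.coe_finsetSum, Finset.sum_apply, Measure.smul_apply, smul_eq_mul]
  exact Finset.measurable_sum _ fun j _ => (hc j).ennreal_ofReal.mul
    ((Measure.measurable_coe hs).comp (Measure.measurable_dirac.comp (hq j)))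

omit [MeasurableSpace E] in
instance isFiniteMeasure_weightedEmpirical (q : E → G) (N : ℕ) (y : Fin N → E) :
    IsFiniteMeasure (weightedEmpirical w q N y) := by
  refine ⟨?_⟩
  simp only [weightedEmpirical, Measure.coe_finsetSum, Finset.sum_apply, Measure.smul_apply,
    smul_eq_mul, measure_univ, mul_one]
  exact ENNReal.sum_lt_top.2 fun _ _ => ENNReal.ofReal_lt_top

omit [MeasurableSpace E] in
theorem integrable_weightedEmpirical {q : E → G} {N : ℕ} (y : Fin N → E) {ψ : G → ℝ}
    (hψ : Measurable ψ) : Integrable ψ (weightedEmpirical w q N y) := by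
  refine integrable_finsetSum_measure.2 fun j _ => Integrable.smul_measure ?_ ENNReal.ofReal_ne_top
  exact (integrable_dirac' hψ.stronglyMeasurable (by simp))

omit [MeasurableSpace E] in
theorem integral_weightedEmpirical (hw : ∀ z, 0 ≤ w z) {q : E → G} {N : ℕ} (y : Fin N → E)
    {ψ : G → ℝ} (hψ : Measurable ψ) :
    ∫ z, ψ z ∂weightedEmpirical w q N y = ∑ j, w (y j) / (∑ i, w (y i)) * ψ (q (y j)) := by
  rw [weightedEmpirical, integral_finsetSum_measure fun j _ => ?_]
  · refine Finset.sum_congr rfl fun j _ => ?_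
    rw [integral_smul_measure, integral_dirac' _ _ hψ.stronglyMeasurable,
      ENNReal.toReal_ofReal (div_nonneg (hw _) (Finset.sum_nonneg fun _ _ => hw _)), smul_eq_mul]
  · exact Integrable.smul_measure (integrable_dirac' hψ.stronglyMeasurable (by simp))
      ENNReal.ofReal_ne_top

omit [MeasurableSpace E] in
theorem isProbabilityMeasure_weightedEmpirical {q : E → G} {N : ℕ} (hN : 0 < N) {y : Fin N → E}
    (hy : ∀ i, 0 < w (y i)) : IsProbabilityMeasure (weightedEmpirical w q N y) := by
  refine ⟨?_⟩
  have hS : 0 < ∑ i, w (y i) :=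
    Finset.sum_pos (fun i _ => hy i) ⟨⟨0, hN⟩, Finset.mem_univ _⟩
  simp only [weightedEmpirical, Measure.coe_finsetSum, Finset.sum_apply, Measure.smul_apply,
    smul_eq_mul, measure_univ, mul_one]
  rw [← ENNReal.ofReal_sum_of_nonneg fun j _ => (div_pos (hy j) hS).le, ← Finset.sum_div,
    div_self hS.ne', ENNReal.ofReal_one]

omit [MeasurableSpace E] in
theorem sum_weight_mul {N : ℕ} (y : Fin N → E) (ψ : E → ℝ) :
    ∑ j, w (y j) / (∑ i, w (y i)) * ψ (y j) = (∑ i, w (y i) * ψ (y i)) / ∑ i, w (y i) := by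
  simp_rw [div_mul_eq_mul_div, Finset.sum_div]

variable {P : ∀ N, Measure (Fin N → E)}

theorem IsConsistent.tendsto_weight (h : IsConsistent P ν) (hr : IsReweighting ν π w)
    [IsProbabilityMeasure π] : TendstoInProb P (fun N y => (N : ℝ) / ∑ i, w (y i)) 1 := by
  have h1 : ∫ z, w z ∂ν = 1 := by simpa using hr.integral fun _ => 1
  have hi : Integrable w ν := by
    simpa using (hr.integrable (fun _ => 1) measurable_const).2 (integrable_const _)
  have h2 := h.tendsto w hr.measurable hi
  rw [h1] at h2
  have h3 := h2.map₂ h2 (F := fun x _ => x⁻¹)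
    (ContinuousAt.inv₀ (f := fun p : ℝ × ℝ => p.1) (by fun_prop) one_ne_zero)
  rw [inv_one] at h3
  simpa only [inv_div] using h3

theorem IsConsistent.tendsto_reweight (h : IsConsistent P ν) (hr : IsReweighting ν π w)
    [IsProbabilityMeasure π] {ψ : E → ℝ} (hψ : Measurable ψ) (hψi : Integrable ψ π) :
    TendstoInProb P (fun _ y => ∑ j, w (y j) / (∑ i, w (y i)) * ψ (y j)) (∫ z, ψ z ∂π) := by
  have h1 := h.tendsto (fun z => w z * ψ z) (hr.measurable.mul hψ) ((hr.integrable ψ hψ).2 hψi)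
  rw [hr.integral] at h1
  have h2 := h1.map₂ (h.tendsto_weight hr) (F := fun x y => x * y) (by fun_prop)
  rw [mul_one] at h2
  refine h2.congr ?_
  filter_upwards [eventually_gt_atTop 0] with N hN
  have hN' : (N : ℝ) ≠ 0 := by exact_mod_cast hN.ne'
  refine ae_of_all _ fun y => ?_
  rw [sum_weight_mul, div_mul_div_comm, mul_comm (N : ℝ), mul_div_mul_right _ _ hN']

/-- The self-normalized sum is the unnormalized one times `N / ∑ w`, a factor tending to 1 in
probability; Slutsky's lemma applies. -/
theorem IsConsistent.asymptoticNormal_reweight (h : IsConsistent P ν) (hr : IsReweighting ν π w)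
    [IsProbabilityMeasure π] [∀ N, IsProbabilityMeasure (P N)] {ψ : E → ℝ} (hψ : Measurable ψ)
    {V : ℝ} (hV : 0 ≤ V)
    (hn : AsymptoticNormal P (fun N y => (∑ i, w (y i) * ψ (y i)) / √N) V) :
    AsymptoticNormal P (fun N y => √N * ∑ j, w (y j) / (∑ i, w (y i)) * ψ (y j)) V := by
  have hw := hr.measurable
  have h1 := hn.mul hV (fun N => by fun_prop) (fun N => by fun_prop) (h.tendsto_weight hr)
  convert h1 using 3 with N y
  rw [sum_weight_mul]
  nth_rewrite 1 [← Real.div_sqrt (x := (N : ℝ))]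
  ring

/-- Almost sure positivity of the weights makes the weighted empirical measure a probability
measure, and `ν ≪ π` keeps its atoms out of null sets of the target. -/
theorem IsConsistent.isPropagation_resample (h : IsConsistent P ν) (hr : IsReweighting ν π w)
    [IsProbabilityMeasure π] {q : E → G} (hq : Measurable q) :
    IsPropagation (Ω := fun N => Fin N → E) P (fun N _ => weightedEmpirical w q N) (π.map q) where
  measurable N _ := by
    have hw := hr.measurable
    exact measurable_sum_smul_dirac (fun j => by fun_prop) (fun j => by fun_prop)
  isFinite N _ y := inferInstance
  isProb N := by
    filter_upwards [h.ae hr.pos N] with y hy i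
    exact isProbabilityMeasure_weightedEmpirical (Nat.pos_of_ne_zero (by rintro rfl; exact i.elim0)) hy
  ac s hs hs0 N := by
    rw [Measure.map_apply hq hs] at hs0
    filter_upwards [h.ac _ (hq hs) (hr.ac hs0) N] with y hy _
    simp only [weightedEmpirical, Measure.coe_finsetSum, Finset.sum_apply, Measure.smul_apply,
      smul_eq_mul]
    refine Finset.sum_eq_zero fun j _ => ?_
    have : q (y j) ∉ s := hy j
    simp [Measure.dirac_apply' _ hs, this]
  integrable ψ hψ _ N := ae_of_all _ fun y _ => integrable_weightedEmpirical y hψ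
  tendsto ψ hψ hψi := by
    rw [integral_map hq.aemeasurable hψ.aestronglyMeasurable]
    refine (h.tendsto_reweight hr (hψ.comp hq)
      ((integrable_map_measure hψ.aestronglyMeasurable hq.aemeasurable).1 hψi)).congr ?_
    filter_upwards [eventually_gt_atTop 0] with N hN
    have hN' : (N : ℝ) ≠ 0 := by exact_mod_cast hN.ne'
    refine ae_of_all _ fun y => ?_
    rw [Finset.sum_const, Finset.card_univ, Fintype.card_fin, nsmul_eq_mul,
      mul_div_cancel_left₀ _ hN', integral_weightedEmpirical hr.nonneg y hψ]
    rfl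

/-- The central limit theorem for the resampling step. -/
theorem IsConsistent.asymptoticNormal_resample (h : IsConsistent P ν) (hr : IsReweighting ν π w)
    [IsProbabilityMeasure π] [∀ N, IsProbabilityMeasure (P N)] {q : E → G} (hq : Measurable q)
    {p : ℝ} (hp : 2 < p) (hp3 : p ≤ 3) {ψ : G → ℝ} (hψ : Measurable ψ)
    (hψL : MemLp ψ (ENNReal.ofReal p) (π.map q)) {V : ℝ} (hV : 0 ≤ V)
    (hn : AsymptoticNormal P (fun N y => (∑ i, w (y i) * ψ (q (y i))) / √N) V) :
    AsymptoticNormal (propagated (Ω := fun N => Fin N → E) P fun N _ => weightedEmpirical w q N)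
      (fun N y => (∑ i, ψ (y i)) / √N) (V + Var[ψ; π.map q]) := by
  have hq' := Measure.isProbabilityMeasure_map (μ := π) hq.aemeasurable
  have hprop := h.isPropagation_resample hr hq
  have hp2 : (2 : ℝ≥0∞) ≤ ENNReal.ofReal p := by
    rw [← ENNReal.ofReal_ofNat]; exact ENNReal.ofReal_le_ofReal hp.le
  refine hprop.asymptoticNormal hp hp3 hψ hψL ?_
    (hprop.tendsto_variance hψ (hψL.mono_exponent hp2))
  -- All `N` conditional means equal the self-normalized estimator, so their sum over `√N` is `√N`
  -- times that estimator.
  convert h.asymptoticNormal_reweight hr (hψ.comp hq) hV hn using 3 with N y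
  rw [Finset.sum_const, Finset.card_univ, Fintype.card_fin, nsmul_eq_mul,
      integral_weightedEmpirical hr.nonneg y hψ, mul_div_right_comm, Real.div_sqrt]
  rfl

end Reweighting

/-! ### The model: equivalence of proposal and target, stability of the function classes -/

namespace Input

variable {Θ 𝒳 𝒮 : Type*} [MeasurableSpace Θ] [MeasurableSpace 𝒳] {n : ℕ}
variable (D : Input Θ 𝒳 𝒮 n)

instance isProbabilityMeasure_prior : IsProbabilityMeasure D.prior := by
  refine ⟨?_⟩
  rw [prior, withDensity_apply _ MeasurableSet.univ, setLIntegral_univ]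
  exact D.lintegral_priorDensity

instance isProbabilityMeasure_unit : IsProbabilityMeasure
    (volume.restrict (Set.Ioo (0 : ℝ) 1)) := ⟨by simp⟩

instance isMarkovKernel_trial (t : ℕ) : IsMarkovKernel (D.trial t) := by
  unfold trial
  infer_instance

/-- Conditioning on an acceptance event of probability zero yields the zero measure, so total mass 1
is available only almost everywhere. -/
instance isFiniteKernel_KA (t : ℕ) : IsFiniteKernel (D.KA t) := by
  refine ⟨1, ENNReal.one_lt_top, fun θ' => ?_⟩
  change ((ProbabilityTheory.cond (D.trial t θ') (D.A t)).map Prod.fst) Set.univ ≤ 1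
  rw [Measure.map_apply measurable_fst MeasurableSet.univ, Set.preimage_univ,
    cond_apply (D.measurableSet_A t), Set.inter_univ]
  exact ENNReal.inv_mul_le_one _

theorem isProbabilityMeasure_KA {t : ℕ} {θ' : Θ} (h : 0 < D.trial t θ' (D.A t)) :
    IsProbabilityMeasure (D.KA t θ') := by
  have := cond_isProbabilityMeasure (μ := D.trial t θ') h.ne'
  exact Measure.isProbabilityMeasure_map measurable_fst.aemeasurable

theorem c_ne_top (t : ℕ) : D.c t ≠ ∞ := by
  obtain ⟨M, hM⟩ := D.bddAbove_mech t
  refine ne_top_of_le_ne_top (b := (M : ℝ≥0∞)) ENNReal.coe_ne_top ?_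
  calc D.c t ≤ ∫⁻ _, (M : ℝ≥0∞) ∂(D.prior ⊗ₘ D.f) :=
        lintegral_mono fun z => ENNReal.coe_le_coe.2 (hM ⟨z.2, rfl⟩)
    _ = M := by simp

theorem measurable_mt (t : ℕ) : Measurable (D.mt t) := D.measurable_mech t

theorem isProbabilityMeasure_posterior {t : ℕ} (h : 0 < D.c t) :
    IsProbabilityMeasure (D.posterior t) := by
  refine ⟨?_⟩
  rw [posterior, Measure.smul_apply, withDensity_apply _ MeasurableSet.univ, setLIntegral_univ,
    smul_eq_mul]
  exact ENNReal.inv_mul_cancel h.ne' (D.c_ne_top t)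

/-- Accepted particles have a law that is dominated by the target, wherever they start. -/
theorem KA_absolutelyContinuous_posterior (t : ℕ) (θ' : Θ) : D.KA t θ' ≪ D.posterior t := by
  have hmt := D.measurable_mt t
  refine Measure.AbsolutelyContinuous.mk fun s hs hs0 => ?_
  rw [posterior, Measure.smul_apply, smul_eq_mul, mul_eq_zero, ENNReal.inv_eq_zero] at hs0
  have h1 := hs0.resolve_left (D.c_ne_top t)
  have hf : Measurable fun z : Θ × (Fin n → 𝒳) => (D.mt t z.2 : ℝ≥0∞) :=
    (hmt.comp measurable_snd).coe_nnreal_ennreal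
  have hms : MeasurableSet {z : Θ × (Fin n → 𝒳) | z ∈ s → D.mt t z.2 = 0} := by
    have : {z : Θ × (Fin n → 𝒳) | z ∈ s → D.mt t z.2 = 0} = sᶜ ∪ {z | D.mt t z.2 = 0} := by
      ext z; simp [imp_iff_not_or]
    rw [this]
    exact hs.compl.union (measurableSet_eq_fun (hmt.comp measurable_snd) measurable_const)
  have h2 : ∀ᵐ z ∂(D.prior ⊗ₘ D.f), z ∈ s → D.mt t z.2 = 0 := by
    rw [withDensity_apply _ hs, setLIntegral_eq_zero_iff hs hf] at h1
    filter_upwards [h1] with z hz hzs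
    exact_mod_cast hz hzs
  rw [Measure.ae_compProd_iff hms, prior, ae_withDensity_iff
    D.measurable_priorDensity.coe_nnreal_ennreal] at h2
  have hms' : MeasurableSet {z : Θ × (Fin n → 𝒳) |
      D.priorDensity z.1 ≠ 0 → z ∈ s → D.mt t z.2 = 0} := by
    have : {z : Θ × (Fin n → 𝒳) | D.priorDensity z.1 ≠ 0 → z ∈ s → D.mt t z.2 = 0}
        = {z | D.priorDensity z.1 = 0} ∪ {z | z ∈ s → D.mt t z.2 = 0} := by
      ext z; simp only [Set.mem_ofPred_eq, Set.mem_union]; tauto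
    rw [this]
    exact (measurableSet_eq_fun (D.measurable_priorDensity.comp measurable_fst)
      measurable_const).union hms
  -- On the set where the prior density is positive, null sets of the prior are null for the
  -- reference measure, hence for `K_t(θ', ·)`.
  have h3 : ∀ᵐ z ∂(D.K t ⊗ₖ Kernel.prodMkLeft Θ D.f) θ',
      D.priorDensity z.1 ≠ 0 → z ∈ s → D.mt t z.2 = 0 := by
    rw [Kernel.ae_compProd_iff hms']
    filter_upwards [(D.K_absolutelyContinuous t θ').ae_le h2] with θ hθ
    rw [Kernel.prodMkLeft_apply]
    by_cases h0 : D.priorDensity θ = 0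
    · simp [h0]
    · filter_upwards [hθ (by exact_mod_cast h0)] with x hx _ using hx
  -- Since `U > 0`, acceptance forces `r_t(x) > 0`, which excludes a vanishing mechanism density.
  have h4 : ∀ᵐ u ∂(volume.restrict (Set.Ioo (0 : ℝ) 1)), 0 < u := by
    filter_upwards [ae_restrict_mem measurableSet_Ioo] with u hu using hu.1
  have h5 : D.trial t θ' (D.A t ∩ Prod.fst ⁻¹' s) = 0 := by
    rw [measure_eq_zero_iff_ae_notMem, trial, Kernel.prod_apply, Kernel.const_apply]
    filter_upwards [Measure.quasiMeasurePreserving_fst.ae h3,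
      Measure.quasiMeasurePreserving_snd.ae h4] with q h3 h4 hq
    have := h3 hq.1.1.ne' hq.2
    have hr : q.2 < D.r t q.1.2 := hq.1.2
    simp only [r, this, NNReal.coe_zero, zero_div] at hr
    exact absurd h4 (not_lt.2 hr.le)
  change ((ProbabilityTheory.cond (D.trial t θ') (D.A t)).map Prod.fst) s = 0
  rw [Measure.map_apply measurable_fst hs, cond_apply (D.measurableSet_A t), h5, mul_zero]

theorem h_absolutelyContinuous_posterior (t : ℕ) : D.h t ≪ D.posterior t := by
  refine Measure.AbsolutelyContinuous.mk fun s hs hs0 => ?_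
  rw [h, Measure.bind_apply hs (D.KA t).aemeasurable]
  simp [fun θ' => D.KA_absolutelyContinuous_posterior t θ' hs0]

/-- The assumptions of the central limit theorem at time `s + 1`. -/
structure IsRegular (s : ℕ) : Prop where
  c_pos : 0 < D.c (s + 1)
  acc : ∀ᵐ θ' ∂D.target s, 0 < D.trial (s + 1) θ' (D.A (s + 1))
  ac : D.posterior (s + 1) ≪ D.h (s + 1)

variable {D}

theorem IsRegular.isProb_KA {s : ℕ} (hs : D.IsRegular s) :
    ∀ᵐ θ' ∂D.target s, IsProbabilityMeasure (D.KA (s + 1) θ') :=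
  hs.acc.mono fun _ h => D.isProbabilityMeasure_KA h

theorem isProbabilityMeasure_target {t : ℕ} (h : ∀ s < t, D.IsRegular s) :
    IsProbabilityMeasure (D.target t) := by
  cases t with
  | zero => exact D.isProbabilityMeasure_prior
  | succ t =>
    have := D.isProbabilityMeasure_posterior (h t t.lt_succ_self).c_pos
    exact Measure.isProbabilityMeasure_map measurable_fst.aemeasurable

theorem isProbabilityMeasure_h {t : ℕ} (h : ∀ s < t + 1, D.IsRegular s) :
    IsProbabilityMeasure (D.h (t + 1)) := by
  have := isProbabilityMeasure_target fun s hs => h s (hs.trans t.lt_succ_self)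
  change IsProbabilityMeasure ((D.target t).bind (D.KA (t + 1)))
  exact isProbabilityMeasure_bind (D.KA (t + 1)).aemeasurable (h t t.lt_succ_self).isProb_KA

/-- The assumed `π ≪ h` makes the Radon–Nikodym derivative an honest density, positive `π`-almost
everywhere; the proved `h ≪ π` carries this positivity over to the particles. -/
theorem isReweighting_w {t : ℕ} (h : ∀ s < t + 1, D.IsRegular s) :
    IsReweighting (D.h (t + 1)) (D.posterior (t + 1)) (D.w (t + 1)) := by
  have hr := h t t.lt_succ_self
  have := isProbabilityMeasure_h h
  have := D.isProbabilityMeasure_posterior hr.c_pos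
  exact
  { measurable := (Measure.measurable_rnDeriv _ _).ennreal_toReal
    nonneg := fun z => ENNReal.toReal_nonneg
    pos := by
      filter_upwards [(D.h_absolutelyContinuous_posterior (t + 1)).ae_le (Measure.rnDeriv_pos hr.ac),
        Measure.rnDeriv_ne_top (D.posterior (t + 1)) (D.h (t + 1))] with z h1 h2
      exact ENNReal.toReal_pos h1.ne' h2
    ac := D.h_absolutelyContinuous_posterior (t + 1)
    integrable := fun ψ _ => integrable_rnDeriv_smul_iff hr.ac
    integral := fun ψ => integral_rnDeriv_smul hr.ac }

theorem measurable_condMean (t : ℕ) {ψ : Θ × (Fin n → 𝒳) → ℝ} (hψ : Measurable ψ) :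
    Measurable (D.condMean t ψ) :=
  measurable_integral_measure (D.KA t).measurable hψ

theorem condMean_ae_eq {t : ℕ} {ψ ψ₁ ψ₂ : Θ × (Fin n → 𝒳) → ℝ} {a : ℝ}
    (h1m : Measurable ψ₁) (h2m : Measurable ψ₂)
    (h1 : Integrable ψ₁ (D.h (t + 1))) (h2 : Integrable ψ₂ (D.h (t + 1)))
    (h : ψ =ᵐ[D.h (t + 1)] fun z => ψ₁ z - a * ψ₂ z) :
    D.condMean (t + 1) ψ =ᵐ[D.target t]
      fun θ' => D.condMean (t + 1) ψ₁ θ' - a * D.condMean (t + 1) ψ₂ θ' := by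
  have h' : ∀ᵐ θ' ∂D.target t, ∀ᵐ z ∂D.KA (t + 1) θ', ψ z = ψ₁ z - a * ψ₂ z :=
    Measure.ae_ae_of_ae_bind (D.KA (t + 1)).aemeasurable h
  filter_upwards [h', ((integrable_bind_iff (D.KA (t + 1)).measurable h1m).1 h1).1,
    ((integrable_bind_iff (D.KA (t + 1)).measurable h2m).1 h2).1] with θ' e i1 i2
  simp only [condMean]
  rw [integral_congr_ae e, integral_sub i1 (i2.const_mul a), integral_const_mul]

/-- Conditional Jensen. It supplies the integrability under the target that resampling needs and
that membership in `F_t^p`, a condition on `w_t g` under `h_t`, does not include. -/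
theorem memLp_condMean {t : ℕ} (hr : D.IsRegular t) {p : ℝ} (hp : 1 ≤ p)
    {ψ : Θ × (Fin n → 𝒳) → ℝ} (hψ : Measurable ψ)
    (hL : MemLp ψ (ENNReal.ofReal p) (D.h (t + 1))) :
    MemLp (D.condMean (t + 1) ψ) (ENNReal.ofReal p) (D.target t) := by
  have hp0 : 0 < p := by linarith
  have hp1 : (1 : ℝ≥0∞) ≤ ENNReal.ofReal p := by
    rw [← ENNReal.ofReal_one]; exact ENNReal.ofReal_le_ofReal hp
  have hm := D.measurable_condMean (t + 1) hψ
  have hi : Integrable (fun z => |ψ z| ^ p) ((D.target t).bind (D.KA (t + 1))) :=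
    (memLp_ofReal_iff hp0 hψ).1 hL
  rw [memLp_ofReal_iff hp0 hm]
  refine (integrable_integral_kernel (hψ.abs.pow_const p) hi).mono'
    (hm.abs.pow_const p).aestronglyMeasurable ?_
  filter_upwards [hr.isProb_KA,
    ((integrable_bind_iff (D.KA (t + 1)).measurable (hψ.abs.pow_const p)).1 hi).1] with θ' hθ i
  have hLθ := (memLp_ofReal_iff hp0 hψ).2 i
  rw [Real.norm_of_nonneg (by positivity)]
  exact (Real.rpow_le_rpow (abs_nonneg _) abs_integral_le_integral_abs hp0.le).trans
      (rpow_integral_le hp (fun z => abs_nonneg _) (hLθ.integrable hp1).abs i)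

theorem integral_condMean {t : ℕ} {ψ : Θ × (Fin n → 𝒳) → ℝ}
    (hi : Integrable ψ (D.h (t + 1))) :
    ∫ θ', D.condMean (t + 1) ψ θ' ∂D.target t = ∫ z, ψ z ∂D.h (t + 1) :=
  (integral_bind (D.KA (t + 1)).measurable hi).symm

theorem MemFParam.mono {p q : ℝ} (hqp : q ≤ p) {t : ℕ} (h : ∀ s < t, D.IsRegular s) {g : Θ → ℝ}
    (hg : D.MemFParam p t g) : D.MemFParam q t g := by
  induction t generalizing g with
  | zero => exact ⟨hg.1, hg.2.mono_exponent (ENNReal.ofReal_le_ofReal hqp)⟩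
  | succ t ih =>
    have := isProbabilityMeasure_h h
    exact ⟨hg.1, hg.2.1.mono_exponent (ENNReal.ofReal_le_ofReal hqp),
      ih (fun s hs => h s (hs.trans t.lt_succ_self)) hg.2.2⟩

/-- Equality almost everywhere is the form that survives the recursion: conditional means are linear
only where the integrals exist, and target-null sets of parameters pull back to `h`-null sets
because `h ≪ π`. -/
theorem MemFParam.of_ae_eq {p : ℝ} (hp : 1 ≤ p) {t : ℕ} (h : ∀ s < t, D.IsRegular s)
    {g g₁ g₂ : Θ → ℝ} {a : ℝ} (hg : Measurable g) (h1 : D.MemFParam p t g₁)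
    (h2 : D.MemFParam p t g₂) (he : g =ᵐ[D.target t] fun θ => g₁ θ - a * g₂ θ) :
    D.MemFParam p t g := by
  have hp1 : (1 : ℝ≥0∞) ≤ ENNReal.ofReal p := by
    rw [← ENNReal.ofReal_one]; exact ENNReal.ofReal_le_ofReal hp
  induction t generalizing g g₁ g₂ with
  | zero => exact ⟨hg, (memLp_congr_ae he).2 (h1.2.sub (h2.2.const_mul a))⟩
  | succ t ih =>
    have := isProbabilityMeasure_h h
    have hw := (isReweighting_w h).measurable
    have he' : (fun z => D.w (t + 1) z * g z.1) =ᵐ[D.h (t + 1)]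
        fun z => D.w (t + 1) z * g₁ z.1 - a * (D.w (t + 1) z * g₂ z.1) := by
      have := ae_of_ae_map (μ := D.posterior (t + 1)) measurable_fst.aemeasurable he
      filter_upwards [(D.h_absolutelyContinuous_posterior (t + 1)).ae_le this] with z hz
      rw [hz]; ring
    refine ⟨hg, (memLp_congr_ae he').2 (h1.2.1.sub (h2.2.1.const_mul a)),
      ih (fun s hs => h s (hs.trans t.lt_succ_self))
        (D.measurable_condMean _ (hw.mul (hg.comp measurable_fst))) h1.2.2 h2.2.2
        (condMean_ae_eq (hw.mul (h1.1.comp measurable_fst)) (hw.mul (h2.1.comp measurable_fst))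
          (h1.2.1.integrable hp1) (h2.2.1.integrable hp1) he')⟩

end Input

/-! ### From characteristic functions to convergence in distribution -/

section Congruence

variable {Ω : ℕ → Type*} [∀ N, MeasurableSpace (Ω N)] {P : ∀ N, Measure (Ω N)}

theorem AsymptoticNormal.congr {X Y : ∀ N, Ω N → ℝ} {V : ℝ} (hX : AsymptoticNormal P X V)
    (h : ∀ᶠ N in atTop, ∀ᵐ ω ∂P N, X N ω = Y N ω) : AsymptoticNormal P Y V := by
  intro u
  refine (hX u).congr' ?_
  filter_upwards [h] with N hN
  refine integral_congr_ae ?_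
  filter_upwards [hN] with ω hω
  rw [hω]

theorem AsymptoticNormal.tendstoInDistribution [∀ N, IsProbabilityMeasure (P N)]
    {X : ∀ N, Ω N → ℝ} {V : ℝ≥0} (hX : AsymptoticNormal P X V) (hXm : ∀ N, Measurable (X N)) :
    TendstoInDistribution X atTop (id : ℝ → ℝ) P (gaussianReal 0 V) where
  forall_aemeasurable N := (hXm N).aemeasurable
  aemeasurable_limit := aemeasurable_id
  tendsto := by
    refine ProbabilityMeasure.tendsto_iff_tendsto_charFun.2 fun u => ?_
    simpa using hX.tendsto_charFun hXm u

end Congruence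

/-! ### Induction over the iterations -/

namespace Input

variable {Θ 𝒳 𝒮 : Type*} [MeasurableSpace Θ] [MeasurableSpace 𝒳] {n : ℕ}
variable (D : Input Θ 𝒳 𝒮 n) (σ : FirstStep)

/-- The ancestors of iteration `t + 1` are well defined and satisfy a law of large numbers and a
central limit theorem. -/
structure AncestorCLT (p : ℝ) (t : ℕ) : Prop where
  isProb : ∀ N, IsProbabilityMeasure (D.ancestorLaw σ N t)
  isConsistent : IsConsistent (fun N => D.ancestorLaw σ N t) (D.target t)
  clt : ∀ g : Θ → ℝ, D.MemFParam p t g → MemLp g (ENNReal.ofReal p) (D.target t) →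
    ∫ θ, g θ ∂D.target t = 0 → D.resampleVar σ t g < ∞ ∧
    AsymptoticNormal (Ω := fun N => Fin N → Θ) (fun N => D.ancestorLaw σ N t)
      (fun N y => (∑ i, g (y i)) / √N) (D.resampleVar σ t g).toReal

variable {D σ}

theorem MemFParam.measurable {p : ℝ} {t : ℕ} {g : Θ → ℝ} (h : D.MemFParam p t g) :
    Measurable g := by
  cases t with
  | zero => exact h.1
  | succ t => exact h.1

theorem two_le_ofReal {p : ℝ} (hp : 2 < p) : (2 : ℝ≥0∞) ≤ ENNReal.ofReal p := by
  rw [← ENNReal.ofReal_ofNat]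
  exact ENNReal.ofReal_le_ofReal hp.le

theorem ancestorLaw_direct (N : ℕ) : D.ancestorLaw .direct N 0 =
    propagated (Ω := fun _ => Unit) (fun _ => Measure.dirac ()) (fun _ _ _ => D.prior) N :=
  (propagated_const D.prior N).symm

theorem ancestorLaw_resampled (N : ℕ) : D.ancestorLaw .resampled N 0 =
    propagated (Ω := fun N => Fin N → Θ) (fun N => D.ancestorLaw .direct N 0)
      (fun N _ => weightedEmpirical (fun _ => 1) id N) N := by
  simp only [ancestorLaw, initialLaw, propagated, resample, weightedEmpirical, id_eq,
    Finset.sum_const, Finset.card_univ, Fintype.card_fin, nsmul_eq_mul, mul_one]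

theorem ancestorCLT_zero_direct {p : ℝ} (hp : 2 < p) (hp3 : p ≤ 3) : D.AncestorCLT .direct p 0 := by
  have hprop := isPropagation_const D.prior
  refine ⟨fun N => ?_, ?_, fun g hg (hgL : MemLp g _ D.prior) hg0 => ⟨?_, ?_⟩⟩
  · rw [ancestorLaw_direct]
    exact hprop.isProbabilityMeasure N
  · simp_rw [ancestorLaw_direct]
    exact hprop.isConsistent
  · exact (hgL.mono_exponent (two_le_ofReal hp)).evariance_lt_top
  · simp_rw [ancestorLaw_direct]
    have h0 : AsymptoticNormal (Ω := fun _ => Unit) (fun _ => Measure.dirac ())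
        (fun N _ => (∑ _i : Fin N, ∫ z, g z ∂D.prior) / √N) 0 := by
      intro u
      have : ∫ z, g z ∂D.prior = 0 := hg0
      simp [this]
    have := hprop.asymptoticNormal hp hp3 hg.1 hgL h0
      (hprop.tendsto_variance hg.1 (hgL.mono_exponent (two_le_ofReal hp)))
    rwa [zero_add] at this

theorem ancestorCLT_zero {p : ℝ} (hp : 2 < p) (hp3 : p ≤ 3) (σ : FirstStep) :
    D.AncestorCLT σ p 0 := by
  have hd := ancestorCLT_zero_direct (D := D) hp hp3
  cases σ with
  | direct => exact hd
  | resampled =>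
    have := hd.isProb
    have hcons : IsConsistent (fun N => D.ancestorLaw .direct N 0) D.prior := hd.isConsistent
    have hprop := hcons.isPropagation_resample (isReweighting_one D.prior) measurable_id
    rw [Measure.map_id] at hprop
    refine ⟨fun N => ?_, ?_, fun g hg hgL hg0 => ?_⟩
    · rw [ancestorLaw_resampled]
      exact hprop.isProbabilityMeasure N
    · simp_rw [ancestorLaw_resampled]
      exact hprop.isConsistent
    · obtain ⟨h1, h2⟩ := hd.clt g hg hgL hg0
      have h1' : evariance g D.prior < ∞ := h1
      have e : D.resampleVar .resampled 0 g = evariance g D.prior + evariance g D.prior := rfl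
      rw [e]
      refine ⟨ENNReal.add_lt_top.2 ⟨h1', h1'⟩, ?_⟩
      simp_rw [ancestorLaw_resampled]
      have h3 := hcons.asymptoticNormal_resample (isReweighting_one D.prior) measurable_id hp hp3
        hg.1 (by rw [Measure.map_id]; exact hgL) ENNReal.toReal_nonneg (by simpa using h2)
      rw [Measure.map_id] at h3
      rw [ENNReal.toReal_add h1'.ne h1'.ne]
      exact h3

/-- Accepted particles satisfy a law of large numbers and a central limit theorem. -/
theorem AncestorCLT.particle {p : ℝ} (hp : 2 < p) (hp3 : p ≤ 3) {t : ℕ}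
    (h : ∀ s < t + 1, D.IsRegular s) (ha : D.AncestorCLT σ p t) :
    (∀ N, IsProbabilityMeasure (D.particleLaw σ N (t + 1))) ∧
    IsConsistent (fun N => D.particleLaw σ N (t + 1)) (D.h (t + 1)) ∧
    ∀ ψ : Θ × (Fin n → 𝒳) → ℝ, Measurable ψ → MemLp ψ (ENNReal.ofReal p) (D.h (t + 1)) →
      ∫ z, ψ z ∂D.h (t + 1) = 0 → D.MemFParam p t (D.condMean (t + 1) ψ) →
      D.propVar (D.resampleVar σ t) (t + 1) ψ < ∞ ∧
      AsymptoticNormal (Ω := fun N => Fin N → Θ × (Fin n → 𝒳))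
        (fun N => D.particleLaw σ N (t + 1)) (fun N y => (∑ i, ψ (y i)) / √N)
        (D.propVar (D.resampleVar σ t) (t + 1) ψ).toReal := by
  have hr := h t t.lt_succ_self
  have := ha.isProb
  have := isProbabilityMeasure_h h
  have hprop : IsPropagation (Ω := fun N => Fin N → Θ) (fun N => D.ancestorLaw σ N t)
      (fun _ i θ => D.KA (t + 1) (θ i)) (D.h (t + 1)) :=
    ha.isConsistent.isPropagation_kernel hr.isProb_KA
  refine ⟨fun N => hprop.isProbabilityMeasure N, hprop.isConsistent, fun ψ hψ hψL hψ0 hF => ?_⟩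
  have hp1 : (1 : ℝ≥0∞) ≤ ENNReal.ofReal p := one_le_two.trans (two_le_ofReal hp)
  have hL2 : MemLp ψ 2 ((D.target t).bind (D.KA (t + 1))) :=
    hψL.mono_exponent (two_le_ofReal hp)
  -- By the tower property the conditional mean of a centred function is again centred, so the
  -- induction hypothesis applies to it.
  obtain ⟨h1, h2⟩ := ha.clt _ hF (memLp_condMean hr (by linarith) hψ hψL)
    ((integral_condMean (hψL.integrable hp1)).trans hψ0)
  have h3 : ∫⁻ θ', evariance ψ (D.KA (t + 1) θ') ∂D.target t < ∞ := by
    rw [lintegral_evariance_kernel hr.isProb_KA hψ hL2]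
    exact ENNReal.ofReal_lt_top
  have e : D.propVar (D.resampleVar σ t) (t + 1) ψ = D.resampleVar σ t (D.condMean (t + 1) ψ)
      + ∫⁻ θ', evariance ψ (D.KA (t + 1) θ') ∂D.target t := rfl
  rw [e]
  refine ⟨ENNReal.add_lt_top.2 ⟨h1, h3⟩, ?_⟩
  rw [ENNReal.toReal_add h1.ne h3.ne]
  exact hprop.asymptoticNormal hp hp3 hψ hψL h2
    (ha.isConsistent.tendsto_variance_kernel hr.isProb_KA hψ hL2)

/-- A `g` centred under the target gives `w g` centred under the proposal. The centring term in the
reweighting variance therefore vanishes, and no constant function has to lie in the classes at this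
stage. -/
theorem AncestorCLT.succ {p : ℝ} (hp : 2 < p) (hp3 : p ≤ 3) {t : ℕ}
    (h : ∀ s < t + 1, D.IsRegular s) (ha : D.AncestorCLT σ p t) :
    D.AncestorCLT σ p (t + 1) := by
  obtain ⟨hprob, hcons, hclt⟩ := ha.particle hp hp3 h
  have := D.isProbabilityMeasure_posterior (h t t.lt_succ_self).c_pos
  have := isProbabilityMeasure_h h
  have hw := isReweighting_w h
  have hp1 : (1 : ℝ≥0∞) ≤ ENNReal.ofReal p := one_le_two.trans (two_le_ofReal hp)
  have hprop := hcons.isPropagation_resample hw measurable_fst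
  refine ⟨fun N => hprop.isProbabilityMeasure N, hprop.isConsistent, fun g hg hgL hg0 => ?_⟩
  have hgm : Measurable fun z : Θ × (Fin n → 𝒳) => g z.1 := hg.measurable.comp measurable_fst
  have hpm : D.postMean (t + 1) (fun z => g z.1) = 0 := by
    rw [postMean, ← hg0, target, integral_map measurable_fst.aemeasurable
      hg.measurable.aestronglyMeasurable]
  obtain ⟨h1, h2⟩ := hclt (fun z => D.w (t + 1) z * g z.1) (hw.measurable.mul hgm) hg.2.1
    ((hw.integral fun z => g z.1).trans hpm) hg.2.2
  have h3 : evariance g (D.target (t + 1)) < ∞ := by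
    have := isProbabilityMeasure_target h
    exact (hgL.mono_exponent (two_le_ofReal hp)).evariance_lt_top
  have h4 : evariance (fun z => g z.1) (D.posterior (t + 1)) = evariance g (D.target (t + 1)) := by
    have hgm' := hg.measurable
    rw [target, evariance, evariance, integral_map measurable_fst.aemeasurable
      hgm'.aestronglyMeasurable, lintegral_map (by fun_prop) measurable_fst]
  have e : D.resampleVar σ (t + 1) g =
      D.propVar (D.resampleVar σ t) (t + 1) (fun z => D.w (t + 1) z * g z.1)
        + evariance g (D.target (t + 1)) := by
    rw [resampleVar, reweightVar, hpm, h4]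
    simp only [sub_zero]
  rw [e]
  refine ⟨ENNReal.add_lt_top.2 ⟨h1, h3⟩, ?_⟩
  rw [ENNReal.toReal_add h1.ne h3.ne]
  exact hcons.asymptoticNormal_resample hw measurable_fst hp hp3 hg.measurable hgL
    ENNReal.toReal_nonneg h2

theorem ancestorCLT {p : ℝ} (hp : 2 < p) (hp3 : p ≤ 3) (σ : FirstStep) {t : ℕ}
    (h : ∀ s < t, D.IsRegular s) : D.AncestorCLT σ p t := by
  induction t with
  | zero => exact ancestorCLT_zero hp hp3 σ
  | succ t ih => exact (ih fun s hs => h s (hs.trans t.lt_succ_self)).succ hp hp3 h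

theorem MemF.mono {p q : ℝ} (hqp : q ≤ p) {t : ℕ} (h : ∀ s < t + 1, D.IsRegular s)
    {φ : Θ × (Fin n → 𝒳) → ℝ} (hφ : D.MemF p (t + 1) φ) : D.MemF q (t + 1) φ := by
  have := isProbabilityMeasure_h h
  exact ⟨hφ.1, hφ.2.1.mono_exponent (ENNReal.ofReal_le_ofReal hqp),
    MemFParam.mono (t := t) hqp (fun s hs => h s (hs.trans t.lt_succ_self)) hφ.2.2⟩

/-- Subtracting `a` from `φ` subtracts `a w` from `w φ`; membership of the constant 1 is exactly
what controls this term through the recursion. -/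
theorem MemF.sub_const {p : ℝ} (hp : 1 ≤ p) {t : ℕ} (h : ∀ s < t + 1, D.IsRegular s)
    {φ : Θ × (Fin n → 𝒳) → ℝ} (hφ : D.MemF p (t + 1) φ)
    (hone : D.MemF p (t + 1) fun _ => 1) (a : ℝ) : D.MemF p (t + 1) fun z => φ z - a := by
  have hp1 : (1 : ℝ≥0∞) ≤ ENNReal.ofReal p := by
    rw [← ENNReal.ofReal_one]; exact ENNReal.ofReal_le_ofReal hp
  have := isProbabilityMeasure_h h
  have hw := (isReweighting_w h).measurable
  have he : (fun z => D.w (t + 1) z * (φ z - a)) =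
      fun z => D.w (t + 1) z * φ z - a * (D.w (t + 1) z * 1) := by
    funext z; ring
  refine ⟨hφ.1.sub_const a, ?_, ?_⟩
  · rw [he]
    exact hφ.2.1.sub (hone.2.1.const_mul a)
  · exact MemFParam.of_ae_eq (t := t) hp (fun s hs => h s (hs.trans t.lt_succ_self))
      (D.measurable_condMean _ (hw.mul (hφ.1.sub_const a))) hφ.2.2 hone.2.2
      (condMean_ae_eq (hw.mul hφ.1) (hw.mul measurable_const)
        (hφ.2.1.integrable hp1) (hone.2.1.integrable hp1) (by rw [he]))

/-- Positive weights on a nonempty system sum to 1 after normalization; with total weight zero,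
division by zero would spoil the identity. -/
theorem estimator_sub {t : ℕ} (φ : Θ × (Fin n → 𝒳) → ℝ) (a : ℝ) {N : ℕ} (hN : 0 < N)
    {y : Fin N → Θ × (Fin n → 𝒳)} (hy : ∀ i, 0 < D.w t (y i)) :
    D.estimator t φ y - a = ∑ j, D.w t (y j) / (∑ i, D.w t (y i)) * (φ (y j) - a) := by
  have hS : 0 < ∑ i, D.w t (y i) :=
    Finset.sum_pos (fun i _ => hy i) ⟨⟨0, hN⟩, Finset.mem_univ _⟩
  simp_rw [mul_sub]
  rw [Finset.sum_sub_distrib, ← Finset.sum_mul, ← Finset.sum_div, div_self hS.ne', one_mul]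
  rfl

theorem measurable_estimator {t : ℕ} {φ : Θ × (Fin n → 𝒳) → ℝ} (hφ : Measurable φ) (N : ℕ) :
    Measurable (D.estimator t φ (N := N)) := by
  have hw : Measurable (D.w t) := (Measure.measurable_rnDeriv _ _).ennreal_toReal
  unfold estimator normWeight
  fun_prop

/-- The central limit theorem for the estimator of the particle filter. -/
theorem asymptoticNormal_estimator {p : ℝ} (hp : 2 < p) (hp3 : p ≤ 3) {t : ℕ}
    (h : ∀ s < t + 1, D.IsRegular s) {φ : Θ × (Fin n → 𝒳) → ℝ} (hφ : D.MemF p (t + 1) φ)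
    (hone : D.MemF p (t + 1) fun _ => 1) :
    D.asympVar σ (t + 1) φ < ∞ ∧ (∀ N, IsProbabilityMeasure (D.particleLaw σ N (t + 1))) ∧
    AsymptoticNormal (Ω := fun N => Fin N → Θ × (Fin n → 𝒳))
      (fun N => D.particleLaw σ N (t + 1))
      (fun N y => √N * (D.estimator (t + 1) φ y - D.postMean (t + 1) φ))
      (D.asympVar σ (t + 1) φ).toReal := by
  obtain ⟨hprob, hcons, hclt⟩ := (ancestorCLT (D := D) hp hp3 σ
    fun s hs => h s (hs.trans t.lt_succ_self)).particle hp hp3 h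
  have := D.isProbabilityMeasure_posterior (h t t.lt_succ_self).c_pos
  have := isProbabilityMeasure_h h
  have hw := isReweighting_w h
  have hp1 : (1 : ℝ≥0∞) ≤ ENNReal.ofReal p := one_le_two.trans (two_le_ofReal hp)
  set a := D.postMean (t + 1) φ with ha
  have hF := hφ.sub_const (by linarith) h hone a
  have hi : Integrable φ (D.posterior (t + 1)) :=
    (hw.integrable φ hφ.1).1 (hφ.2.1.integrable hp1)
  have h0 : ∫ z, D.w (t + 1) z * (φ z - a) ∂D.h (t + 1) = 0 := by
    rw [hw.integral fun z => φ z - a, integral_sub hi (integrable_const _)]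
    simp [ha, postMean]
  obtain ⟨h1, h2⟩ := hclt _ (hw.measurable.mul hF.1) hF.2.1 h0 hF.2.2
  refine ⟨h1, hprob, ?_⟩
  refine (hcons.asymptoticNormal_reweight hw hF.1 ENNReal.toReal_nonneg h2).congr ?_
  filter_upwards [eventually_gt_atTop 0] with N hN
  filter_upwards [hcons.ae hw.pos N] with y hy
  rw [estimator_sub φ a hN hy]

end Input

end DPPF

theorem mainTheorem2 {Θ 𝒳 𝒮 : Type*} [MeasurableSpace Θ] [MeasurableSpace 𝒳] {n : ℕ}
    (D : DPPF.Input Θ 𝒳 𝒮 n) (σ : DPPF.FirstStep) (t : ℕ) (ht : 1 ≤ t)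
    -- the private posteriors are well defined
    (hc : ∀ s, 1 ≤ s → s ≤ t → 0 < D.c s)
    -- propagation trials from an ancestor succeed with positive probability
    (hacc : ∀ s, 1 ≤ s → s ≤ t → ∀ᵐ θ' ∂(D.target (s - 1)), 0 < D.trial s θ' (D.A s))
    -- the importance weights are well defined
    (hw : ∀ s, 1 ≤ s → s ≤ t → D.posterior s ≪ D.h s)
    (φ : Θ × (Fin n → 𝒳) → ℝ)
    (hφ : ∃ ζ : ℝ, 0 < ζ ∧ D.MemF (2 + ζ) t φ)
    (hone : ∃ ζ : ℝ, 0 < ζ ∧ D.MemF (2 + ζ) t (fun _ => 1)) :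
    D.asympVar σ t φ < ∞ ∧
    ∃ _ : ∀ N, IsProbabilityMeasure (D.particleLaw σ N t),
      TendstoInDistribution
        (fun (N : ℕ) (y : Fin N → Θ × (Fin n → 𝒳)) => √(N : ℝ) * (D.estimator t φ y - D.postMean t φ)) atTop
        (id : ℝ → ℝ) (fun N : ℕ => D.particleLaw σ N t)
        (gaussianReal 0 (D.asympVar σ t φ).toNNReal) := by
  obtain ⟨t, rfl⟩ : ∃ s, t = s + 1 := ⟨t - 1, by omega⟩
  obtain ⟨ζ₁, hζ₁, hφ⟩ := hφ
  obtain ⟨ζ₂, hζ₂, hone⟩ := hone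
  have hr : ∀ s < t + 1, D.IsRegular s := fun s hs =>
    ⟨hc (s + 1) (by omega) hs, hacc (s + 1) (by omega) hs, hw (s + 1) (by omega) hs⟩
  -- One exponent serves both `φ` and the constant 1, and the cap at 3 is the range of the Taylor
  -- bound. Lowering the exponent is harmless under probability measures.
  set p := 2 + min (min ζ₁ ζ₂) 1 with hp
  have hp2 : 2 < p := by
    have : 0 < min (min ζ₁ ζ₂) 1 := lt_min (lt_min hζ₁ hζ₂) one_pos
    linarith
  have hp3 : p ≤ 3 := by
    have : min (min ζ₁ ζ₂) 1 ≤ 1 := min_le_right _ _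
    linarith
  have h1 : p ≤ 2 + ζ₁ := by
    have : min (min ζ₁ ζ₂) 1 ≤ ζ₁ := (min_le_left _ _).trans (min_le_left _ _)
    linarith
  have h2 : p ≤ 2 + ζ₂ := by
    have : min (min ζ₁ ζ₂) 1 ≤ ζ₂ := (min_le_left _ _).trans (min_le_right _ _)
    linarith
  obtain ⟨hV, hprob, hclt⟩ := DPPF.Input.asymptoticNormal_estimator (σ := σ) hp2 hp3 hr
    (DPPF.Input.MemF.mono h1 hr hφ) (DPPF.Input.MemF.mono h2 hr hone)
  exact ⟨hV, hprob, DPPF.AsymptoticNormal.tendstoInDistribution hclt fun N =>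
    ((DPPF.Input.measurable_estimator hφ.1 N).sub_const _).const_mul _⟩
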